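/- Let $1\le \ell\le d$ be integers. Let $f:\mathbb{R}^d\to\mathbb{R}$ be continuously differentiable with $\lambda$-Lipschitz gradient (for the Euclidean norm), $\gamma$-strongly convex for some $\gamma>0$, and attaining its minimum $f_*$. Let $P_0,P_1,P_2,\dots$ be i.i.d. random $d\times\ell$ matrices, each with the law of $\sqrt{d/\ell}\,Q\,I_{d\times\ell}$, where $I_{d\times\ell}$ truncates $Q$ to its first $\ell$ columns and $Q$ is the orthogonal factor in the decomposition $Z=QR$ (with $R$ upper triangular, $R_{ii}>0$) of a $d\times d$ matrix $Z$ with independent standard normal entries. Let $x_0\in\mathbb{R}^d$ be deterministic with $f(x_0)>f_*$, and let $$x_{k+1}=x_k-\alpha P_kP_k^\top\nabla f(x_k),\qquad \alpha=\frac{\ell}{d\lambda}.$$ Let $\epsilon\in(0,1)$ and $\delta\in(0,1)$ be such that $\delta\le \mathbb{P}\bigl(X\ge (1-\epsilon)\ell/d\bigr)$, where $X\sim\mathrm{Beta}\bigl(\ell/2,(d-\ell)/2\bigr)$ (with $X=1$ if $\ell=d$). Then for every integer $k\ge 1$ and every $t\in(0,\delta]$, $$\mathbb{P}\bigl(f(x_k)-f_*\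 \ge\ \rho^k\,(f(x_0)-f_*)\bigr)\ \le\ \exp\left(-\frac{(kt)^2}{2\sigma_k^2}\right),\qquad \rho=\left(1-(1-\epsilon)\frac{\ell\gamma}{d\lambda}\right)^{\delta-t},$$ where $\sigma_k^2=\dfrac{k(1-2\delta)}{2\log((1-\delta)/\delta)}$ if $\delta\ne 1/2$ and $\sigma_k^2=k/4$ if $\delta=1/2$; this is the optimal sub-Gaussian proxy variance of a $\mathrm{Binomial}(k,\delta)$ variable. -/

import Mathlib

open MeasureTheory ProbabilityTheory

namespace SubspaceDescent

/-- The product sigma-algebra on real matrices (all entries are measurable). -/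
instance instMeasurableSpaceMatrix {m n : Type*} : MeasurableSpace (Matrix m n ℝ) :=
  inferInstanceAs (MeasurableSpace (m → n → ℝ))

/-- The law of a random `d × d` matrix with independent standard normal entries. -/
noncomputable def gaussianMatrix (d : ℕ) : Measure (Matrix (Fin d) (Fin d) ℝ) :=
  Measure.pi fun _ : Fin d => Measure.pi fun _ : Fin d => gaussianReal 0 1

/-- The `j`-th column of a matrix, as a vector of Euclidean space. -/
noncomputable def column {d : ℕ} (Z : Matrix (Fin d) (Fin d) ℝ) (j : Fin d) :
    EuclideanSpace ℝ (Fin d) :=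
  WithLp.toLp 2 fun i => Z i j

/-- The factor `Q` of the decomposition `Z = Q R` of an invertible matrix `Z`, with `Q` orthogonal
and `R` upper triangular with positive diagonal; its columns are obtained from those of `Z` by the
Gram-Schmidt process. -/
noncomputable def qrFactor {d : ℕ} (Z : Matrix (Fin d) (Fin d) ℝ) : Matrix (Fin d) (Fin d) ℝ :=
  Matrix.of fun i j => InnerProductSpace.gramSchmidtNormed ℝ (column Z) j i

/-- `qrFactor Z` is indeed the orthogonal factor of a QR decomposition of `Z` in which the diagonal
of the triangular factor is positive. -/
theorem qrFactor_spec {d : ℕ} (Z : Matrix (Fin d) (Fin d) ℝ) (hZ : IsUnit Z.det) :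
    qrFactor Z ∈ Matrix.orthogonalGroup (Fin d) ℝ ∧
      ∃ R : Matrix (Fin d) (Fin d) ℝ, R.IsUpperTriangular ∧ (∀ i, 0 < R i i) ∧
        Z = qrFactor Z * R := by
  have hli : LinearIndependent ℝ (column Z) := by
    have h1 : LinearIndependent ℝ Z.col := by
      rw [Matrix.linearIndependent_cols_iff_isUnit, Matrix.isUnit_iff_isUnit_det]
      exact hZ
    exact h1.map' (WithLp.linearEquiv 2 ℝ (Fin d → ℝ)).symm.toLinearMap
      (LinearEquiv.ker _)
  have hon := InnerProductSpace.gramSchmidtNormed_orthonormal (𝕜 := ℝ) hli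
  have hQ : (qrFactor Z).transpose * qrFactor Z = 1 := by
    ext i j
    have := orthonormal_iff_ite.mp hon i j
    rw [Matrix.one_apply, ← this]
    simp [Matrix.mul_apply, qrFactor, PiLp.inner_apply, mul_comm]
  have hQ' : qrFactor Z * (qrFactor Z).transpose = 1 := mul_eq_one_comm.mp hQ
  have hR : ∀ i j, ((qrFactor Z).transpose * Z) i j =
      inner ℝ (InnerProductSpace.gramSchmidtNormed ℝ (column Z) i) (column Z j) := by
    intro i j
    simp [Matrix.mul_apply, qrFactor, column, PiLp.inner_apply, mul_comm]
  refine ⟨(Matrix.mem_orthogonalGroup_iff (Fin d) ℝ).mpr hQ', (qrFactor Z).transpose * Z, ?_, ?_, ?_⟩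
  · intro i j hij
    rw [hR, InnerProductSpace.gramSchmidtNormed, inner_smul_left,
      InnerProductSpace.gramSchmidt_inv_triangular ℝ (column Z) (show j < i from hij), mul_zero]
  · intro i
    rw [hR, InnerProductSpace.gramSchmidtNormed, inner_smul_left]
    have h0 : InnerProductSpace.gramSchmidt ℝ (column Z) i ≠ 0 :=
      InnerProductSpace.gramSchmidt_ne_zero i hli
    have h1 : inner ℝ (InnerProductSpace.gramSchmidt ℝ (column Z) i) (column Z i) =
        ‖InnerProductSpace.gramSchmidt ℝ (column Z) i‖ ^ 2 := by
      have hdef := InnerProductSpace.gramSchmidt_def'' ℝ (column Z) i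
      refine (congrArg (inner ℝ (InnerProductSpace.gramSchmidt ℝ (column Z) i)) hdef).trans ?_
      rw [inner_add_right, inner_sum, Finset.sum_eq_zero, add_zero, real_inner_self_eq_norm_sq]
      intro k hk
      rw [inner_smul_right, InnerProductSpace.gramSchmidt_orthogonal ℝ (column Z)
        (Finset.mem_Iio.mp hk).ne', mul_zero]
    rw [h1]
    have := norm_pos_iff.mpr h0
    simp only [RCLike.ofReal_real_eq_id, id_eq, conj_trivial]
    positivity
  · rw [← mul_assoc, hQ', one_mul]

theorem measurable_qrFactor (d : ℕ) :
    Measurable (qrFactor : Matrix (Fin d) (Fin d) ℝ → Matrix (Fin d) (Fin d) ℝ) := by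
  have hentry : ∀ i j : Fin d, Measurable fun Z : Matrix (Fin d) (Fin d) ℝ => Z i j :=
    fun i j => (measurable_pi_apply j).comp (measurable_pi_apply i)
  have hcol : ∀ j : Fin d, Measurable fun Z : Matrix (Fin d) (Fin d) ℝ => column Z j := fun j =>
    (PiLp.continuous_toLp 2 _).measurable.comp (measurable_pi_lambda _ fun i => hentry i j)
  have hgs : ∀ j : Fin d, Measurable fun Z : Matrix (Fin d) (Fin d) ℝ =>
      InnerProductSpace.gramSchmidt ℝ (column Z) j := by
    intro j
    induction j using WellFoundedLT.induction with
    | ind j ih =>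
      simp only [InnerProductSpace.gramSchmidt_def ℝ _ j, Submodule.starProjection_singleton]
      refine (hcol j).sub (Finset.measurable_sum _ fun i hi => ?_)
      have hi' := ih i (Finset.mem_Iio.mp hi)
      have h2 : Measurable fun Z : Matrix (Fin d) (Fin d) ℝ =>
          (inner ℝ (InnerProductSpace.gramSchmidt ℝ (column Z) i) (column Z j) : ℝ) :=
        Measurable.inner (𝕜 := ℝ) hi' (hcol j)
      exact (h2.div (hi'.norm.pow_const 2)).smul hi'
  refine measurable_pi_lambda _ fun i => measurable_pi_lambda _ fun j => ?_
  have h : Measurable fun Z : Matrix (Fin d) (Fin d) ℝ =>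
      InnerProductSpace.gramSchmidtNormed ℝ (column Z) j :=
    ((hgs j).norm.inv).smul (hgs j)
  exact (measurable_pi_apply i).comp ((PiLp.continuous_ofLp 2 _).measurable.comp h)

/-- The matrix `√(d/ℓ) Q I_{d×ℓ}`, that is, the first `ℓ` columns of the orthogonal factor of `Z`,
rescaled by `√(d/ℓ)`. -/
noncomputable def scaledTruncation {d ℓ : ℕ} (hℓ : ℓ ≤ d) (Z : Matrix (Fin d) (Fin d) ℝ) :
    Matrix (Fin d) (Fin ℓ) ℝ :=
  Real.sqrt ((d : ℝ) / ℓ) • (qrFactor Z).submatrix id (Fin.castLE hℓ)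

/-- The Haar-type law on `d × ℓ` matrices: the law of `√(d/ℓ) Q I_{d×ℓ}`, where `Q` is the
orthogonal QR factor of a matrix with independent standard normal entries. -/
noncomputable def haarLaw {d ℓ : ℕ} (hℓ : ℓ ≤ d) : Measure (Matrix (Fin d) (Fin ℓ) ℝ) :=
  (gaussianMatrix d).map (scaledTruncation hℓ)

theorem measurable_scaledTruncation {d ℓ : ℕ} (hℓ : ℓ ≤ d) :
    Measurable (scaledTruncation hℓ : Matrix (Fin d) (Fin d) ℝ → Matrix (Fin d) (Fin ℓ) ℝ) := by
  refine measurable_pi_lambda _ fun i => measurable_pi_lambda _ fun j => ?_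
  exact measurable_const.mul ((measurable_pi_apply (Fin.castLE hℓ j)).comp
    ((measurable_pi_apply i).comp (measurable_qrFactor d)))

theorem isProbabilityMeasure_haarLaw {d ℓ : ℕ} (hℓ : ℓ ≤ d) :
    IsProbabilityMeasure (haarLaw hℓ) := by
  have : IsProbabilityMeasure (gaussianMatrix d) :=
    inferInstanceAs (IsProbabilityMeasure
      (Measure.pi fun _ : Fin d => Measure.pi fun _ : Fin d => gaussianReal 0 1))
  exact Measure.isProbabilityMeasure_map (measurable_scaledTruncation hℓ).aemeasurable

/-- The law `Beta(a, b)`, with the usual convention that `Beta(a, 0)` is the point mass at `1`. -/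
noncomputable def betaLaw (a b : ℝ) : Measure ℝ :=
  if b = 0 then Measure.dirac 1 else betaMeasure a b

/-- The probability `ℙ(X ≥ (1 - ε) ℓ / d)`, where `X ∼ Beta(ℓ/2, (d - ℓ)/2)`. -/
noncomputable def embeddingProb (d ℓ : ℕ) (ε : ℝ) : ℝ :=
  (betaLaw ((ℓ : ℝ) / 2) (((d : ℝ) - ℓ) / 2)).real (Set.Ici ((1 - ε) * ℓ / d))

/-- The optimal sub-Gaussian proxy variance of a `Binomial(k, δ)` variable, for `0 < δ < 1`. -/
noncomputable def proxyVariance (k : ℕ) (δ : ℝ) : ℝ :=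
  if δ = 1 / 2 then (k : ℝ) / 4
  else (k : ℝ) * (1 - 2 * δ) / (2 * Real.log ((1 - δ) / δ))

end SubspaceDescent

namespace SubspaceDescent

/-! Write r for `contractionFactor`, the base of ρ. Almost surely PᵀP = (d/ℓ)I, so the descent lemma
with step ℓ/(dλ) lowers f by ℓ/(2dλ)·‖Pᵀ∇f‖². The gap f - f_* therefore never grows, and by the
Polyak-Łojasiewicz inequality it shrinks by the factor r whenever ‖Pᵀ∇f‖² ≥ (1-ε)‖∇f‖². Given the
past, this good event has probability at least δ (`haarLaw_real_eq`), so heuristically the number of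
good steps dominates a Binomial(k, δ) variable, and failure means at most (δ-t)k good steps.

No coupling is built. For θ > 0, independence gives E[gap_{k+1}^θ] ≤ (1-δ+δr^θ) E[gap_k^θ]
(`lintegral_gap_iterate_le`). With r^θ = e^{-s}, Markov's inequality for gap^θ becomes exactly the
binomial Chernoff bound, and the Kearns-Saul inequality `bernoulli_mgf_le` at the optimal s yields
the stated exponent.

The good event is computed by randomising the vector: by rotation invariance of the Gaussian matrix
its probability is the same for all nonzero u, so u may be replaced by an independent Gaussian
vector g. For fixed Z, the coordinates of g in the Gram-Schmidt basis are again standard normal, and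
the share of ‖g‖² in ℓ of them is Beta(ℓ/2, (d-ℓ)/2). -/

/-! ### The Kearns-Saul inequality. -/

/-- The odd power series of log((1+x)/(1-x)) has nonnegative coefficients, so its quotient by x is
monotone on (0, 1); compare termwise. -/
theorem mul_log_sub_log_le {x y : ℝ} (hx : 0 < x) (hxy : x ≤ y) (hy : y < 1) :
    y * (Real.log (1 + x) - Real.log (1 - x)) ≤ x * (Real.log (1 + y) - Real.log (1 - y)) := by
  have h1 := (Real.hasSum_log_sub_log_of_abs_lt_one
    (abs_lt.2 ⟨by linarith, by linarith⟩ : |x| < 1)).mul_left y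
  have h2 := (Real.hasSum_log_sub_log_of_abs_lt_one
    (abs_lt.2 ⟨by linarith, by linarith⟩ : |y| < 1)).mul_left x
  refine hasSum_le (fun k => ?_) h1 h2
  have h3 : x ^ (2 * k) ≤ y ^ (2 * k) := pow_le_pow_left₀ hx.le hxy _
  have h4 : 0 ≤ x * y * (2 * (1 / (2 * (k : ℝ) + 1))) := by
    have : 0 < y := hx.trans_le hxy
    positivity
  calc y * (2 * (1 / (2 * (k : ℝ) + 1)) * x ^ (2 * k + 1))
      = x * y * (2 * (1 / (2 * (k : ℝ) + 1))) * x ^ (2 * k) := by ring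
    _ ≤ x * y * (2 * (1 / (2 * (k : ℝ) + 1))) * y ^ (2 * k) := by gcongr
    _ = _ := by ring

/-- The negative entropy of a Bernoulli variable of mean `(1 - x) / 2`, minus a quadratic. -/
noncomputable def tiltedNegEntropy (c x : ℝ) : ℝ :=
  (1 - x) / 2 * Real.log ((1 - x) / 2) + (1 + x) / 2 * Real.log ((1 + x) / 2) - c * x ^ 2 / 4

theorem tiltedNegEntropy_neg (c x : ℝ) : tiltedNegEntropy c (-x) = tiltedNegEntropy c x := by
  simp only [tiltedNegEntropy, sub_neg_eq_add, ← sub_eq_add_neg, neg_sq]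
  ring

theorem tiltedNegEntropy_abs (c x : ℝ) : tiltedNegEntropy c |x| = tiltedNegEntropy c x := by
  rcases abs_choice x with h | h <;> rw [h]
  exact tiltedNegEntropy_neg c x

theorem hasDerivAt_tiltedNegEntropy (c : ℝ) {x : ℝ} (h1 : -1 < x) (h2 : x < 1) :
    HasDerivAt (tiltedNegEntropy c)
      ((Real.log (1 + x) - Real.log (1 - x) - c * x) / 2) x := by
  have a1 : HasDerivAt (fun x : ℝ => (1 - x) / 2) (-1 / 2) x :=
    ((hasDerivAt_id x).const_sub 1).div_const 2
  have a2 : HasDerivAt (fun x : ℝ => (1 + x) / 2) (1 / 2) x :=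
    ((hasDerivAt_id x).const_add 1).div_const 2
  have p1 : (1 - x) / 2 ≠ 0 := by linarith
  have p2 : (1 + x) / 2 ≠ 0 := by linarith
  have b1 := a1.mul (a1.log p1)
  have b2 := a2.mul (a2.log p2)
  have b3 := (((hasDerivAt_id x).pow 2).const_mul c).div_const 4
  refine ((b1.add b2).sub b3).congr_deriv ?_
  rw [Real.log_div (by linarith) (by norm_num), Real.log_div (by linarith) (by norm_num)]
  have p1' : 1 - x ≠ 0 := by linarith
  have p2' : 1 + x ≠ 0 := by linarith
  simp only [id]
  field_simp
  ring

/-- The coefficient is the one that makes the derivative vanish at a. Monotonicity of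
log((1+y)/(1-y))/y makes the derivative nonpositive before a and nonnegative after it. -/
theorem tiltedNegEntropy_le {a x : ℝ} (ha : 0 < a) (ha1 : a < 1) (hx : 0 ≤ x) (hx1 : x < 1) :
    tiltedNegEntropy ((Real.log (1 + a) - Real.log (1 - a)) / a) a ≤
      tiltedNegEntropy ((Real.log (1 + a) - Real.log (1 - a)) / a) x := by
  set c := (Real.log (1 + a) - Real.log (1 - a)) / a with hc
  have hd : ∀ y ∈ Set.Ioo (-1 : ℝ) 1, HasDerivAt (tiltedNegEntropy c)
      ((Real.log (1 + y) - Real.log (1 - y) - c * y) / 2) y :=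
    fun y hy => hasDerivAt_tiltedNegEntropy c hy.1 hy.2
  rcases le_total x a with h | h
  · have hanti : AntitoneOn (tiltedNegEntropy c) (Set.Icc 0 a) := by
      refine antitoneOn_of_deriv_nonpos (convex_Icc 0 a)
        (fun y hy => (hd y ⟨by linarith [hy.1], by linarith [hy.2]⟩).continuousAt.continuousWithinAt)
        (fun y hy => ?_) fun y hy => ?_
      all_goals rw [interior_Icc] at hy
      · exact (hd y ⟨by linarith [hy.1], by linarith [hy.2]⟩).differentiableAt.differentiableWithinAt
      · rw [(hd y ⟨by linarith [hy.1], by linarith [hy.2]⟩).deriv]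
        have := mul_log_sub_log_le hy.1 hy.2.le ha1
        have h3 : Real.log (1 + y) - Real.log (1 - y) ≤ c * y := by
          rw [hc, div_mul_eq_mul_div, le_div_iff₀ ha]
          linarith
        linarith
    exact hanti ⟨hx, h⟩ ⟨ha.le, le_rfl⟩ h
  · have hmono : MonotoneOn (tiltedNegEntropy c) (Set.Icc a x) := by
      refine monotoneOn_of_deriv_nonneg (convex_Icc a x)
        (fun y hy => (hd y ⟨by linarith [hy.1], by linarith [hy.2]⟩).continuousAt.continuousWithinAt)
        (fun y hy => ?_) fun y hy => ?_
      all_goals rw [interior_Icc] at hy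
      · exact (hd y ⟨by linarith [hy.1], by linarith [hy.2]⟩).differentiableAt.differentiableWithinAt
      · rw [(hd y ⟨by linarith [hy.1], by linarith [hy.2]⟩).deriv]
        have := mul_log_sub_log_le ha hy.1.le (hy.2.trans hx1)
        have h3 : c * y ≤ Real.log (1 + y) - Real.log (1 - y) := by
          rw [hc, div_mul_eq_mul_div, div_le_iff₀ ha]
          linarith
        linarith
    exact hmono ⟨le_rfl, h⟩ ⟨h, le_rfl⟩ h

/-- The inverse of twice the optimal proxy variance of a Bernoulli variable. -/
noncomputable def bernoulliRate (p : ℝ) : ℝ := Real.log ((1 - p) / p) / (1 - 2 * p)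

/-- The rate is invariant under p ↦ 1 - p; in this form it is the coefficient of
`tiltedNegEntropy_le` at a = |1 - 2p|. -/
theorem bernoulliRate_eq {p : ℝ} (hp0 : 0 < p) (hp1 : p < 1) :
    bernoulliRate p = (Real.log (1 + |1 - 2 * p|) - Real.log (1 - |1 - 2 * p|)) / |1 - 2 * p| := by
  have e : Real.log ((1 - p) / p) = Real.log (1 + (1 - 2 * p)) - Real.log (1 - (1 - 2 * p)) := by
    rw [← Real.log_div (by linarith) (by linarith)]
    congr 1
    have : 1 - (1 - 2 * p) ≠ 0 := by linarith
    field_simp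
    ring
  rw [bernoulliRate, e]
  rcases abs_choice (1 - 2 * p) with h | h <;> rw [h]
  rw [div_neg, ← neg_div, sub_neg_eq_add, ← sub_eq_add_neg]
  ring_nf

theorem bernoulliRate_pos {p : ℝ} (hp0 : 0 < p) (hp1 : p < 1) (hp : p ≠ 1 / 2) :
    0 < bernoulliRate p := by
  have hne : 1 - 2 * p ≠ 0 := fun h => hp (by linarith)
  have ha : 0 < |1 - 2 * p| := abs_pos.2 hne
  have ha1 : |1 - 2 * p| < 1 := abs_lt.2 ⟨by linarith, by linarith⟩
  rw [bernoulliRate_eq hp0 hp1]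
  exact div_pos (sub_pos.2 (Real.log_lt_log (by linarith) (by linarith))) ha

/-- A sharp quadratic lower bound for the relative entropy of two Bernoulli laws. -/
theorem bernoulliRate_mul_sq_le {p q : ℝ} (hp0 : 0 < p) (hp1 : p < 1) (hp : p ≠ 1 / 2)
    (hq0 : 0 < q) (hq1 : q < 1) :
    bernoulliRate p * (q - p) ^ 2 ≤
      q * Real.log (q / p) + (1 - q) * Real.log ((1 - q) / (1 - p)) := by
  have hne : 1 - 2 * p ≠ 0 := fun h => hp (by linarith)
  have key := tiltedNegEntropy_le (abs_pos.2 hne) (abs_lt.2 ⟨by linarith, by linarith⟩)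
    (abs_nonneg (1 - 2 * q)) (abs_lt.2 ⟨by linarith, by linarith⟩)
  rw [← bernoulliRate_eq hp0 hp1, tiltedNegEntropy_abs, tiltedNegEntropy_abs] at key
  -- With this slope, relative entropy minus the quadratic equals the difference of the tilted
  -- entropies at 1 - 2q and 1 - 2p: the terms linear in q cancel.
  have hc : Real.log (1 - p) - Real.log p = bernoulliRate p * (1 - 2 * p) := by
    rw [bernoulliRate, div_mul_cancel₀ _ hne, Real.log_div (by linarith) (by linarith)]
  simp only [tiltedNegEntropy] at key
  rw [show (1 - (1 - 2 * p)) / 2 = p by ring, show (1 + (1 - 2 * p)) / 2 = 1 - p by ring,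
    show (1 - (1 - 2 * q)) / 2 = q by ring, show (1 + (1 - 2 * q)) / 2 = 1 - q by ring] at key
  rw [Real.log_div (by linarith) (by linarith), Real.log_div (by linarith) (by linarith)]
  have e : Real.log (1 - p) = Real.log p + bernoulliRate p * (1 - 2 * p) := by linarith
  rw [e] at key ⊢
  linarith

theorem proxyVariance_one_pos {p : ℝ} (hp0 : 0 < p) (hp1 : p < 1) : 0 < proxyVariance 1 p := by
  unfold proxyVariance
  split_ifs with h
  · norm_num
  · have := bernoulliRate_pos hp0 hp1 h
    rw [bernoulliRate] at this
    have h2 : ((1 : ℕ) : ℝ) * (1 - 2 * p) / (2 * Real.log ((1 - p) / p)) =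
        (Real.log ((1 - p) / p) / (1 - 2 * p))⁻¹ / 2 := by
      rw [inv_div, Nat.cast_one]
      ring
    rw [h2]
    positivity

theorem proxyVariance_eq_mul (k : ℕ) (p : ℝ) : proxyVariance k p = k * proxyVariance 1 p := by
  unfold proxyVariance
  split_ifs <;> push_cast <;> ring

/-- The Kearns-Saul inequality: the centred Bernoulli law is sub-Gaussian with its optimal proxy
variance. -/
theorem bernoulli_mgf_le {p : ℝ} (hp0 : 0 < p) (hp1 : p < 1) (s : ℝ) :
    Real.exp (s * p) * (1 - p + p * Real.exp (-s)) ≤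
      Real.exp (s ^ 2 * proxyVariance 1 p / 2) := by
  by_cases hp : p = 1 / 2
  -- At p = 1/2 the rate is 0/0, and the claim is the bound on cosh.
  · have h := Real.cosh_le_exp_half_sq (s / 2)
    have e : Real.exp (s * p) * (1 - p + p * Real.exp (-s)) = Real.cosh (s / 2) := by
      rw [Real.cosh_eq, hp, show -s = -(s / 2) + -(s / 2) by ring, Real.exp_add,
        show s * (1 / 2) = s / 2 by ring]
      have := Real.exp_pos (s / 2)
      rw [Real.exp_neg]
      field_simp
      ring
    rw [e]
    refine h.trans (le_of_eq ?_)
    rw [proxyVariance, if_pos hp]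
    push_cast
    ring_nf
  · have hc := bernoulliRate_pos hp0 hp1 hp
    have hv : proxyVariance 1 p = 1 / (2 * bernoulliRate p) := by
      rw [proxyVariance, if_neg hp, bernoulliRate]
      push_cast
      rw [one_mul, mul_div_assoc', one_div_div]
    set c := bernoulliRate p
    have hE := Real.exp_pos (-s)
    set Z := 1 - p + p * Real.exp (-s) with hZ
    have hZ0 : 0 < Z := by
      have : 0 < 1 - p := by linarith
      positivity
    -- The exponentially tilted mean. For it the relative entropy is -sq - log Z, so the entropy
    -- bound controls log Z.
    set q := p * Real.exp (-s) / Z with hq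
    have hq0 : 0 < q := by positivity
    have hq1' : 1 - q = (1 - p) / Z := by
      rw [hq]
      field_simp
      rw [hZ]
      ring
    have hq1 : q < 1 := by
      have : 0 < (1 - p) / Z := div_pos (by linarith) hZ0
      linarith
    have key := bernoulliRate_mul_sq_le hp0 hp1 hp hq0 hq1
    have e1 : q / p = Real.exp (-s) / Z := by rw [hq]; field_simp
    have e2 : (1 - q) / (1 - p) = 1 / Z := by
      rw [hq1']
      have : 1 - p ≠ 0 := by linarith
      field_simp
    rw [e1, e2, Real.log_div hE.ne' hZ0.ne', Real.log_exp, Real.log_div one_ne_zero hZ0.ne',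
      Real.log_one] at key
    have hlog : s * p + Real.log Z ≤ s ^ 2 * (1 / (2 * c)) / 2 := by
      have h1 : s * p + Real.log Z ≤ s * (p - q) - c * (p - q) ^ 2 := by nlinarith
      refine h1.trans ?_
      -- Complete the square: the maximum over p - q is s²/(4c).
      have h2 : s ^ 2 * (1 / (2 * c)) / 2 - (s * (p - q) - c * (p - q) ^ 2) =
          (s - 2 * c * (p - q)) ^ 2 / (4 * c) := by
        field_simp
        ring
      have : 0 ≤ (s - 2 * c * (p - q)) ^ 2 / (4 * c) := by positivity
      linarith
    rw [hv]
    calc Real.exp (s * p) * Z = Real.exp (s * p + Real.log Z) := by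
          rw [Real.exp_add, Real.exp_log hZ0]
      _ ≤ _ := Real.exp_le_exp.2 hlog

/-! ### Smoothness and strong convexity. -/

section Smooth

variable {E : Type*} [NormedAddCommGroup E] [InnerProductSpace ℝ E] [CompleteSpace E]

theorem hasDerivAt_comp_line {f : E → ℝ} (hf : Differentiable ℝ f) (x v : E) (t : ℝ) :
    HasDerivAt (fun t : ℝ => f (x + t • v)) (inner ℝ (gradient f (x + t • v)) v) t := by
  have h1 : HasDerivAt (fun t : ℝ => x + t • v) v t := by
    simpa using ((hasDerivAt_id t).smul_const v).const_add x
  have h2 := (hf (x + t • v)).hasGradientAt.hasFDerivAt.comp_hasDerivAt t h1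
  simpa using! h2

/-- The descent lemma for functions with Lipschitz gradient. -/
theorem le_add_inner_gradient_add_sq {f : E → ℝ} (hf : Differentiable ℝ f) {K : NNReal}
    (hK : LipschitzWith K (gradient f)) (x v : E) :
    f (x + v) ≤ f x + inner ℝ (gradient f x) v + K / 2 * ‖v‖ ^ 2 := by
  have hd : ∀ t : ℝ, HasDerivAt
      (fun t : ℝ => f (x + t • v) - t * inner ℝ (gradient f x) v - K / 2 * t ^ 2 * ‖v‖ ^ 2)
      (inner ℝ (gradient f (x + t • v)) v - inner ℝ (gradient f x) v - K * t * ‖v‖ ^ 2) t := by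
    intro t
    have h1 := ((hasDerivAt_comp_line hf x v t).sub
      ((hasDerivAt_id t).mul_const (inner ℝ (gradient f x) v))).sub
      ((((hasDerivAt_id t).pow 2).const_mul ((K : ℝ) / 2)).mul_const (‖v‖ ^ 2))
    refine h1.congr_deriv ?_
    simp only [id]
    ring
  -- Along the segment, f minus its quadratic majorant decreases, by Cauchy-Schwarz and the
  -- Lipschitz bound; compare t = 0 with t = 1.
  have hanti : AntitoneOn
      (fun t : ℝ => f (x + t • v) - t * inner ℝ (gradient f x) v - K / 2 * t ^ 2 * ‖v‖ ^ 2)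
      (Set.Icc 0 1) := by
    refine antitoneOn_of_deriv_nonpos (convex_Icc 0 1)
      (fun t _ => (hd t).continuousAt.continuousWithinAt)
      (fun t _ => (hd t).differentiableAt.differentiableWithinAt) fun t ht => ?_
    rw [interior_Icc] at ht
    rw [(hd t).deriv, ← inner_sub_left]
    have h1 := real_inner_le_norm (gradient f (x + t • v) - gradient f x) v
    have h2 := hK.dist_le_mul (x + t • v) x
    rw [dist_eq_norm, dist_eq_norm, add_sub_cancel_left, norm_smul, Real.norm_of_nonneg ht.1.le]
      at h2
    nlinarith [mul_le_mul_of_nonneg_right h2 (norm_nonneg v)]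
  have := hanti (Set.left_mem_Icc.2 zero_le_one) (Set.right_mem_Icc.2 zero_le_one) zero_le_one
  simp only [one_smul, zero_smul, add_zero] at this
  linarith

/-- The first order characterisation of strong convexity. -/
theorem add_inner_gradient_add_sq_le {f : E → ℝ} (hf : Differentiable ℝ f) {γ : ℝ}
    (hγ : StrongConvexOn Set.univ γ f) (x v : E) :
    f x + inner ℝ (gradient f x) v + γ / 2 * ‖v‖ ^ 2 ≤ f (x + v) := by
  have h0 := hasDerivAt_comp_line hf x v 0
  rw [zero_smul, add_zero] at h0
  have h1 := h0.tendsto_slope_zero_right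
  simp only [zero_add, zero_smul, add_zero] at h1
  -- Strong convexity on the segment bounds the difference quotient by this function of t; the
  -- factor 1 - t disappears as t ↓ 0.
  have h2 : Filter.Tendsto (fun t : ℝ => f (x + v) - f x - γ / 2 * (1 - t) * ‖v‖ ^ 2)
      (nhdsWithin 0 (Set.Ioi 0)) (nhds (f (x + v) - f x - γ / 2 * (1 - 0) * ‖v‖ ^ 2)) :=
    (Continuous.tendsto (by fun_prop) 0).mono_left nhdsWithin_le_nhds
  have h3 := le_of_tendsto_of_tendsto h1 h2 (by
    filter_upwards [Ioo_mem_nhdsGT (zero_lt_one' ℝ)] with t ht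
    have h4 := hγ.2 (Set.mem_univ x) (Set.mem_univ (x + v)) (sub_nonneg.2 ht.2.le) ht.1.le
      (sub_add_cancel 1 t)
    have e : (1 - t) • x + t • (x + v) = x + t • v := by module
    rw [e] at h4
    simp only [smul_eq_mul, sub_add_cancel_left, norm_neg] at h4 ⊢
    rw [inv_mul_le_iff₀ ht.1]
    nlinarith)
  linarith

/-- The Polyak-Łojasiewicz inequality. -/
theorem two_mul_sub_le_norm_gradient_sq {f : E → ℝ} (hf : Differentiable ℝ f) {γ : ℝ}
    (hγ0 : 0 < γ) (hγ : StrongConvexOn Set.univ γ f) (x y : E) :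
    2 * γ * (f x - f y) ≤ ‖gradient f x‖ ^ 2 := by
  have h1 := add_inner_gradient_add_sq_le hf hγ x (y - x)
  rw [add_sub_cancel] at h1
  have h2 := abs_le.1 (abs_real_inner_le_norm (gradient f x) (y - x))
  -- The square encodes minimising the quadratic lower bound over ‖y - x‖.
  nlinarith [sq_nonneg (‖gradient f x‖ - γ * ‖y - x‖), h2.1]

/-- The quadratic upper and lower bounds along one nonzero direction force this; it keeps the
contraction factor positive. -/
theorem strongConvexOn_modulus_le_lipschitz [Nontrivial E] {f : E → ℝ} (hf : Differentiable ℝ f)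
    {K : NNReal} (hK : LipschitzWith K (gradient f)) {γ : ℝ}
    (hγ : StrongConvexOn Set.univ γ f) : γ ≤ K := by
  obtain ⟨v, hv⟩ := exists_ne (0 : E)
  have h1 := le_add_inner_gradient_add_sq hf hK 0 v
  have h2 := add_inner_gradient_add_sq_le hf hγ 0 v
  have h3 : 0 < ‖v‖ ^ 2 := by have := norm_pos_iff.2 hv; positivity
  by_contra! h
  nlinarith

end Smooth

/-! ### Gamma and Beta laws. -/

theorem measurable_gammaPDF (a r : ℝ) : Measurable (gammaPDF a r) :=
  (measurable_gammaPDFReal a r).ennreal_ofReal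

theorem measurable_betaPDF (a b : ℝ) : Measurable (betaPDF a b) :=
  (measurable_betaPDFReal a b).ennreal_ofReal

theorem lintegral_comp_mul_left_real {s : ℝ} (hs : s ≠ 0) {F : ℝ → ENNReal} (hF : Measurable F) :
    ∫⁻ x, F x = ENNReal.ofReal |s| * ∫⁻ w, F (s * w) := by
  conv_lhs => rw [← Real.smul_map_volume_mul_left hs]
  rw [lintegral_smul_measure, lintegral_map hF (measurable_const_mul s), smul_eq_mul]

/-- The density identity for the change of variables (s, w) ↦ (sw, s - sw), with Jacobian |s|. The
excluded null values are where conventions for the densities at endpoints could break it. -/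
theorem gammaPDF_mul_gammaPDF {a b r s w : ℝ} (ha : 0 < a) (hb : 0 < b) (hr : 0 < r)
    (hs : s ≠ 0) (hw0 : w ≠ 0) (hw1 : w ≠ 1) :
    ENNReal.ofReal |s| * (gammaPDF a r (s * w) * gammaPDF b r (s - s * w)) =
      gammaPDF (a + b) r s * betaPDF a b w := by
  rcases lt_or_gt_of_ne hs with hs | hs
  · rw [gammaPDF_of_neg hs, zero_mul]
    rcases lt_or_gt_of_ne hw0 with h | h
    · rw [gammaPDF_of_neg (x := s - s * w) (by nlinarith), mul_zero, mul_zero]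
    · rw [gammaPDF_of_neg (x := s * w) (by nlinarith), zero_mul, mul_zero]
  · rcases lt_or_gt_of_ne hw0 with h | h
    · rw [gammaPDF_of_neg (x := s * w) (by nlinarith), betaPDF_eq_zero_of_nonpos h.le]
      simp
    rcases lt_or_gt_of_ne hw1 with h1 | h1
    · have h1' : 0 < 1 - w := by linarith
      rw [show s - s * w = s * (1 - w) by ring, gammaPDF_of_nonneg hs.le,
        gammaPDF_of_nonneg (by positivity), gammaPDF_of_nonneg (by positivity),
        betaPDF_of_pos_lt_one h h1, ← ENNReal.ofReal_mul' (by positivity),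
        ← ENNReal.ofReal_mul (by positivity), ← ENNReal.ofReal_mul' ?_]
      · congr 1
        have e1 : s ^ (a + b - 1) = s ^ (a - 1) * s ^ (b - 1) * s := by
          rw [show a + b - 1 = (a - 1) + (b - 1) + 1 by ring, Real.rpow_add hs, Real.rpow_add hs,
            Real.rpow_one]
        have e2 : Real.exp (-(r * s)) =
            Real.exp (-(r * (s * w))) * Real.exp (-(r * (s * (1 - w)))) := by
          rw [← Real.exp_add]
          ring_nf
        rw [abs_of_pos hs, Real.mul_rpow hs.le h.le, Real.mul_rpow hs.le h1'.le, e1, e2,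
          Real.rpow_add hr, beta]
        have ga := Real.Gamma_pos_of_pos ha
        have gb := Real.Gamma_pos_of_pos hb
        have gab := Real.Gamma_pos_of_pos (add_pos ha hb)
        field_simp
      · have := beta_pos ha hb
        positivity
    · rw [gammaPDF_of_neg (x := s - s * w) (by nlinarith), betaPDF_eq_zero_of_one_le h1.le]
      simp

/-- For independent `S ∼ Gamma(a + b, r)` and `W ∼ Beta(a, b)`, the variables `S W` and `S (1 - W)`
are independent with laws `Gamma(a, r)` and `Gamma(b, r)`. -/
theorem map_gamma_prod_beta {a b r : ℝ} (ha : 0 < a) (hb : 0 < b) (hr : 0 < r) :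
    ((gammaMeasure (a + b) r).prod (betaMeasure a b)).map
      (fun p : ℝ × ℝ => (p.1 * p.2, p.1 - p.1 * p.2)) =
      (gammaMeasure a r).prod (gammaMeasure b r) := by
  have := isProbabilityMeasure_gammaMeasure ha hr
  have := isProbabilityMeasure_gammaMeasure hb hr
  have := isProbabilityMeasure_gammaMeasure (add_pos ha hb) hr
  have := isProbabilityMeasureBeta ha hb
  have mga := measurable_gammaPDF a r
  have mgb := measurable_gammaPDF b r
  have mgab := measurable_gammaPDF (a + b) r
  have mbe := measurable_betaPDF a b
  refine Measure.ext_of_lintegral _ fun Φ hΦ => ?_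
  have hT : Measurable (fun p : ℝ × ℝ => (p.1 * p.2, p.1 - p.1 * p.2)) := by fun_prop
  rw [lintegral_map hΦ hT]
  simp only [gammaMeasure, betaMeasure]
  rw [prod_withDensity mgab mbe, prod_withDensity mga mgb,
    lintegral_withDensity_eq_lintegral_mul _ (by fun_prop)
      (show Measurable fun p : ℝ × ℝ => Φ (p.1 * p.2, p.1 - p.1 * p.2) from hΦ.comp hT),
    lintegral_withDensity_eq_lintegral_mul _ (by fun_prop) hΦ]
  rw [lintegral_prod _ (by fun_prop), lintegral_prod _ (by fun_prop)]
  simp only [Pi.mul_apply]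
  have hF : Measurable (fun p : ℝ × ℝ => gammaPDF a r p.1 * gammaPDF b r p.2 * Φ p) := by
    fun_prop
  -- Substitute x = sw at fixed s, exchange the integrals, then translate by y = s - x.
  calc ∫⁻ s, ∫⁻ w, gammaPDF (a + b) r s * betaPDF a b w * Φ (s * w, s - s * w)
      = ∫⁻ s, ∫⁻ x, gammaPDF a r x * gammaPDF b r (s - x) * Φ (x, s - x) := by
        refine lintegral_congr_ae ?_
        filter_upwards [compl_mem_ae_iff.2 (measure_singleton (0 : ℝ))] with s hs
        have hs : s ≠ 0 := hs
        rw [lintegral_comp_mul_left_real hs (F := fun x => gammaPDF a r x * gammaPDF b r (s - x) *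
          Φ (x, s - x)) (by fun_prop), ← lintegral_const_mul _ (by fun_prop)]
        refine lintegral_congr_ae ?_
        filter_upwards [compl_mem_ae_iff.2 (measure_singleton (0 : ℝ)),
          compl_mem_ae_iff.2 (measure_singleton (1 : ℝ))] with w hw0 hw1
        rw [← gammaPDF_mul_gammaPDF ha hb hr hs hw0 hw1, mul_assoc]
    _ = ∫⁻ x, ∫⁻ s, gammaPDF a r x * gammaPDF b r (s - x) * Φ (x, s - x) := by
        refine lintegral_lintegral_swap (Measurable.aemeasurable ?_)
        exact hF.comp (f := fun p : ℝ × ℝ => (p.2, p.1 - p.2)) (by fun_prop)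
    _ = ∫⁻ x, ∫⁻ y, gammaPDF a r x * gammaPDF b r y * Φ (x, y) := by
        refine lintegral_congr fun x => ?_
        exact lintegral_sub_right_eq_self
          (fun y => gammaPDF a r x * gammaPDF b r y * Φ (x, y)) x

theorem map_add_gamma_prod_gamma {a b r : ℝ} (ha : 0 < a) (hb : 0 < b) (hr : 0 < r) :
    ((gammaMeasure a r).prod (gammaMeasure b r)).map (fun p : ℝ × ℝ => p.1 + p.2) =
      gammaMeasure (a + b) r := by
  have := isProbabilityMeasure_gammaMeasure (add_pos ha hb) hr
  have := isProbabilityMeasureBeta ha hb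
  rw [← map_gamma_prod_beta ha hb hr, Measure.map_map (by fun_prop) (by fun_prop)]
  have e : ((fun p : ℝ × ℝ => p.1 + p.2) ∘ fun p : ℝ × ℝ => (p.1 * p.2, p.1 - p.1 * p.2)) =
      Prod.fst := by
    ext p
    simp
  rw [e, Measure.map_fst_prod, measure_univ, one_smul]

/-- In the representation (SW, S(1-W)) the event reads cS ≤ SW, and S > 0 almost surely cancels. -/
theorem gamma_prod_gamma_ratio {a b r : ℝ} (ha : 0 < a) (hb : 0 < b) (hr : 0 < r) (c : ℝ) :
    ((gammaMeasure a r).prod (gammaMeasure b r)) {p | c * (p.1 + p.2) ≤ p.1} =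
      betaMeasure a b (Set.Ici c) := by
  have := isProbabilityMeasure_gammaMeasure (add_pos ha hb) hr
  have := isProbabilityMeasureBeta ha hb
  have hm : MeasurableSet {p : ℝ × ℝ | c * (p.1 + p.2) ≤ p.1} :=
    measurableSet_le (by fun_prop) (by fun_prop)
  rw [← map_gamma_prod_beta ha hb hr, Measure.map_apply (by fun_prop) hm]
  have hpos : ∀ᵐ s ∂(gammaMeasure (a + b) r), 0 < s := by
    rw [gammaMeasure, ae_withDensity_iff (measurable_gammaPDF _ _)]
    filter_upwards [compl_mem_ae_iff.2 (measure_singleton (0 : ℝ))] with s hs h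
    by_contra! h'
    exact h (gammaPDF_of_neg (lt_of_le_of_ne h' hs))
  have hpos' : ∀ᵐ p ∂((gammaMeasure (a + b) r).prod (betaMeasure a b)), 0 < p.1 :=
    Measure.quasiMeasurePreserving_fst.ae hpos
  have e : ((fun p : ℝ × ℝ => (p.1 * p.2, p.1 - p.1 * p.2)) ⁻¹' {p | c * (p.1 + p.2) ≤ p.1})
      =ᵐ[(gammaMeasure (a + b) r).prod (betaMeasure a b)] Set.univ ×ˢ Set.Ici c := by
    filter_upwards [hpos'] with p hp
    refine propext ?_
    change c * (p.1 * p.2 + (p.1 - p.1 * p.2)) ≤ p.1 * p.2 ↔ p ∈ Set.univ ×ˢ Set.Ici c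
    rw [add_sub_cancel, mul_comm c, mul_le_mul_iff_right₀ hp]
    simp
  rw [measure_congr e, Measure.prod_prod, measure_univ, one_mul]

/-! ### Sums of squares of Gaussian coordinates. -/

/-- The square of a standard normal variable is a chi-squared variable. -/
theorem map_sq_gaussianReal :
    (gaussianReal 0 1).map (fun x => x ^ 2) = gammaMeasure (1 / 2) (1 / 2) := by
  refine Measure.ext_of_lintegral _ fun φ hφ => ?_
  have hsq : Measurable (fun x : ℝ => x ^ 2) := by fun_prop
  rw [lintegral_map hφ hsq, gaussianReal_of_var_ne_zero _ one_ne_zero, gammaMeasure,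
    lintegral_withDensity_eq_lintegral_mul _ (measurable_gaussianPDF 0 1)
      (show Measurable fun x : ℝ => φ (x ^ 2) from hφ.comp hsq),
    lintegral_withDensity_eq_lintegral_mul _ (measurable_gammaPDF _ _) hφ]
  simp only [Pi.mul_apply]
  -- The factor 1/2 accounts for the two branches of x ↦ x²: each half-line carries half of the
  -- mass.
  have hpdf : ∀ x : ℝ, x ≠ 0 → gaussianPDF 0 1 x * φ (x ^ 2) =
      2⁻¹ * (ENNReal.ofReal |2 * x| * (gammaPDF (1 / 2) (1 / 2) (x ^ 2) * φ (x ^ 2))) := by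
    intro x hx
    have hx' : 0 < |x| := abs_pos.2 hx
    rw [← mul_assoc, ← mul_assoc, gammaPDF_of_nonneg (sq_nonneg x)]
    congr 1
    rw [gaussianPDF, show (2⁻¹ : ENNReal) = ENNReal.ofReal 2⁻¹ by
        rw [ENNReal.ofReal_inv_of_pos two_pos]; simp,
      ← ENNReal.ofReal_mul (by positivity), ← ENNReal.ofReal_mul (by positivity)]
    congr 1
    rw [gaussianPDFReal, Real.Gamma_one_half_eq, ← sq_abs x,
      show (1 / 2 - 1 : ℝ) = -(1 / 2) by norm_num, Real.rpow_neg (by positivity),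
      ← Real.sqrt_eq_rpow, ← Real.sqrt_eq_rpow, Real.sqrt_sq hx'.le, abs_mul]
    have h1 : -(x - 0) ^ 2 / (2 * ((1 : NNReal) : ℝ)) = -(1 / 2 * |x| ^ 2) := by
      rw [sq_abs]
      simp
      ring
    rw [h1, NNReal.coe_one, mul_one, Real.sqrt_mul zero_le_two, Real.sqrt_div zero_le_one,
      Real.sqrt_one, abs_of_pos (two_pos (α := ℝ))]
    field_simp
  have himg : ∀ s : Set ℝ, MeasurableSet s → Set.InjOn (fun x : ℝ => x ^ 2) s →
      (fun x : ℝ => x ^ 2) '' s = Set.Ioi 0 →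
      ∫⁻ y in Set.Ioi 0, gammaPDF (1 / 2) (1 / 2) y * φ y =
        ∫⁻ x in s, ENNReal.ofReal |2 * x| * (gammaPDF (1 / 2) (1 / 2) (x ^ 2) * φ (x ^ 2)) := by
    intro s hs hinj himg
    rw [← himg]
    refine lintegral_image_eq_lintegral_abs_deriv_mul hs (fun x _ => ?_) hinj _
    simpa using! (hasDerivAt_pow 2 x).hasDerivWithinAt
  have hpos := himg (Set.Ioi 0) measurableSet_Ioi
    (fun x hx y hy h => (pow_left_inj₀ (le_of_lt hx) (le_of_lt hy) two_ne_zero).1 h) (by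
      ext y
      constructor
      · rintro ⟨x, hx, rfl⟩
        exact pow_pos (show (0 : ℝ) < x from hx) 2
      · exact fun hy => ⟨√y, Real.sqrt_pos.2 hy, Real.sq_sqrt (le_of_lt hy)⟩)
  have hneg := himg (Set.Iio 0) measurableSet_Iio
    (fun x hx y hy h => by
      have hx : x < 0 := hx
      have hy : y < 0 := hy
      have h : x ^ 2 = y ^ 2 := h
      nlinarith) (by
      ext y
      constructor
      · rintro ⟨x, hx, rfl⟩
        exact sq_pos_of_neg (show x < 0 from hx)
      · exact fun hy => ⟨-√y, neg_lt_zero.2 (Real.sqrt_pos.2 hy), by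
          simpa using Real.sq_sqrt (le_of_lt hy)⟩)
  have hsplit : ∀ F : ℝ → ENNReal, ∫⁻ x, F x = (∫⁻ x in Set.Iio 0, F x) + ∫⁻ x in Set.Ioi 0, F x := by
    intro F
    rw [← lintegral_add_compl F (measurableSet_Iio (a := (0 : ℝ))), Set.compl_Iio,
      setLIntegral_congr Ioi_ae_eq_Ici]
  have hgauss : ∫⁻ x, gaussianPDF 0 1 x * φ (x ^ 2) = ∫⁻ x, 2⁻¹ *
      (ENNReal.ofReal |2 * x| * (gammaPDF (1 / 2) (1 / 2) (x ^ 2) * φ (x ^ 2))) := by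
    refine lintegral_congr_ae ?_
    filter_upwards [compl_mem_ae_iff.2 (measure_singleton (0 : ℝ))] with x hx using hpdf x hx
  rw [hgauss, lintegral_const_mul' _ _ (by simp), hsplit, ← hneg, ← hpos, ← two_mul, ← mul_assoc,
    ENNReal.inv_mul_cancel two_ne_zero ENNReal.ofNat_ne_top, one_mul,
    hsplit fun y => gammaPDF (1 / 2) (1 / 2) y * φ y,
    setLIntegral_congr_fun measurableSet_Iio (g := fun _ => 0)
      (fun x (hx : x < 0) => by rw [gammaPDF_of_neg hx, zero_mul]), lintegral_zero, zero_add]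

theorem map_eval_sq_gaussian {ι : Type*} [Fintype ι] (i : ι) :
    (Measure.pi fun _ : ι => gaussianReal 0 1).map (fun g => g i ^ 2) =
      gammaMeasure (1 / 2) (1 / 2) := by
  have h := (measurePreserving_eval (fun _ : ι => gaussianReal 0 1) i).map_eq
  have h2 := Measure.map_map (μ := Measure.pi fun _ : ι => gaussianReal 0 1)
    (g := fun x : ℝ => x ^ 2) (by fun_prop) (measurable_pi_apply i)
  rw [h, map_sq_gaussianReal] at h2
  exact h2.symm

theorem map_sum_sq_gaussian {ι : Type*} [Fintype ι] (s : Finset ι) (hs : s.Nonempty) :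
    (Measure.pi fun _ : ι => gaussianReal 0 1).map (fun g => ∑ i ∈ s, g i ^ 2) =
      gammaMeasure ((s.card : ℝ) / 2) (1 / 2) := by
  classical
  induction hs using Finset.Nonempty.cons_induction with
  | singleton i =>
    simp only [Finset.sum_singleton, Finset.card_singleton, Nat.cast_one]
    exact map_eval_sq_gaussian i
  | cons i s hi hs ih =>
    have hind : iIndepFun (fun i (g : ι → ℝ) => g i ^ 2)
        (Measure.pi fun _ : ι => gaussianReal 0 1) :=
      iIndepFun_pi (X := fun _ x => x ^ 2) fun i => by fun_prop
    have h1 := (hind.indepFun_finsetSum_of_notMem (fun i => by fun_prop) hi).symm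
    have h2 := (indepFun_iff_map_prod_eq_prod_map_map (Measurable.aemeasurable (by fun_prop))
    (Measurable.aemeasurable (by fun_prop))).1 h1
    have e : (∑ j ∈ s, fun g : ι → ℝ => g j ^ 2) = fun g => ∑ j ∈ s, g j ^ 2 := by
      ext g
      simp
    rw [e, map_eval_sq_gaussian, ih] at h2
    have h3 := congrArg (fun m => m.map fun p : ℝ × ℝ => p.1 + p.2) h2
    simp only at h3
    rw [Measure.map_map (by fun_prop) (by fun_prop), map_add_gamma_prod_gamma (by norm_num)
      (by have := hs.card_pos; positivity) (by norm_num)] at h3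
    simp only [Finset.sum_cons, Finset.card_cons]
    rw [show ((s.card + 1 : ℕ) : ℝ) / 2 = 1 / 2 + (s.card : ℝ) / 2 by push_cast; ring, ← h3]
    rfl

/-- The fraction of the squared norm of a standard Gaussian vector that is carried by a set of
coordinates has a Beta law. -/
theorem pi_gaussian_ratio {ι : Type*} [Fintype ι] [DecidableEq ι] (s : Finset ι) (hs : s.Nonempty)
    (hs' : sᶜ.Nonempty) (c : ℝ) :
    (Measure.pi fun _ : ι => gaussianReal 0 1) {g | c * ∑ i, g i ^ 2 ≤ ∑ i ∈ s, g i ^ 2} =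
      betaMeasure ((s.card : ℝ) / 2) ((sᶜ.card : ℝ) / 2) (Set.Ici c) := by
  have hind : iIndepFun (fun i (g : ι → ℝ) => g i ^ 2)
      (Measure.pi fun _ : ι => gaussianReal 0 1) :=
    iIndepFun_pi (X := fun _ x => x ^ 2) fun i => by fun_prop
  have h1 := (hind.indepFun_finset s sᶜ disjoint_compl_right (fun i => by fun_prop)).comp
    (φ := fun v : s → ℝ => ∑ i, v i) (ψ := fun v : (sᶜ : Finset ι) → ℝ => ∑ i, v i)
    (by fun_prop) (by fun_prop)
  have e : ∀ t : Finset ι, ((fun v : t → ℝ => ∑ i, v i) ∘ fun (g : ι → ℝ) (i : t) => g i ^ 2) =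
      fun g => ∑ i ∈ t, g i ^ 2 := by
    intro t
    ext g
    exact Finset.sum_coe_sort t fun i => g i ^ 2
  rw [e, e] at h1
  have h2 := (indepFun_iff_map_prod_eq_prod_map_map (Measurable.aemeasurable (by fun_prop))
    (Measurable.aemeasurable (by fun_prop))).1 h1
  rw [map_sum_sq_gaussian s hs, map_sum_sq_gaussian _ hs'] at h2
  rw [← gamma_prod_gamma_ratio (r := 1 / 2) (by have := hs.card_pos; positivity)
    (by have := hs'.card_pos; positivity) (by norm_num), ← h2, Measure.map_apply (by fun_prop)
    (measurableSet_le (by fun_prop) (by fun_prop))]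
  congr 1
  ext g
  simp only [Set.mem_ofPred_eq, Set.mem_preimage, Finset.sum_add_sum_compl]

/-! ### Almost sure invertibility of the Gaussian matrix. -/

/-- Induct on the number of variables, viewing p as a univariate polynomial over the others. Its
leading coefficient is almost surely nonzero, leaving finitely many roots, which the atomless μ
ignores; conclude by Fubini. -/
theorem ae_eval_mvPolynomial_ne_zero (μ : Measure ℝ) [IsProbabilityMeasure μ] [NullSingletonClass μ] {n : ℕ}
    (p : MvPolynomial (Fin n) ℝ) (hp : p ≠ 0) :
    ∀ᵐ x ∂(Measure.pi fun _ : Fin n => μ), MvPolynomial.eval x p ≠ 0 := by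
  induction n with
  | zero =>
    refine ae_of_all _ fun x h => hp ?_
    rw [MvPolynomial.eq_C_of_isEmpty p] at h ⊢
    rw [MvPolynomial.eval_C] at h
    rw [h, MvPolynomial.C_0]
  | succ n ih =>
    have hq : MvPolynomial.finSuccEquiv ℝ n p ≠ 0 := by
      rwa [Ne, EmbeddingLike.map_eq_zero_iff]
    have h1 := ih _ (Polynomial.leadingCoeff_ne_zero.2 hq)
    have hmp := (measurePreserving_piFinSuccAbove (fun _ : Fin (n + 1) => μ) 0).symm
    have hms : MeasurableSet {x : Fin (n + 1) → ℝ | MvPolynomial.eval x p ≠ 0} :=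
      (measurableSet_eq_fun (MvPolynomial.continuous_eval p).measurable measurable_const).compl
    rw [← hmp.map_eq, ae_map_iff hmp.measurable.aemeasurable hms,
      Measure.ae_prod_iff_ae_ae (p := fun z => MvPolynomial.eval
        ((MeasurableEquiv.piFinSuccAbove (fun _ : Fin (n + 1) => ℝ) 0).symm z) p ≠ 0)
        (hmp.measurable hms),
      Measure.ae_ae_comm (p := fun a y => MvPolynomial.eval
        ((MeasurableEquiv.piFinSuccAbove (fun _ : Fin (n + 1) => ℝ) 0).symm (a, y)) p ≠ 0)
        (hmp.measurable hms)]
    filter_upwards [h1] with y hy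
    · have hne : (MvPolynomial.finSuccEquiv ℝ n p).map (MvPolynomial.eval y) ≠ 0 := by
        intro h0
        apply hy
        have := congrArg (fun r => Polynomial.coeff r (MvPolynomial.finSuccEquiv ℝ n p).natDegree) h0
        simpa using this
      have hfin := (Polynomial.finite_setOfPred_isRoot hne).countable.ae_notMem μ
      filter_upwards [hfin] with x hx h
      apply hx
      change Polynomial.eval _ _ = 0
      rw [← MvPolynomial.eval_eq_eval_mv_eval']
      convert h
      ext i
      refine Fin.cases ?_ (fun j => ?_) i <;> simp [MeasurableEquiv.piFinSuccAbove]

theorem isProbabilityMeasure_gaussianMatrix (d : ℕ) :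
    IsProbabilityMeasure (gaussianMatrix d) :=
  inferInstanceAs (IsProbabilityMeasure
    (Measure.pi fun _ : Fin d => Measure.pi fun _ : Fin d => gaussianReal 0 1))

theorem measurable_matrix_entry {m n : Type*} (i : m) (j : n) :
    Measurable fun Z : Matrix m n ℝ => Z i j :=
  (measurable_pi_apply j).comp (measurable_pi_apply i)

/-- Serves both to treat the determinant as a polynomial in d² independent variables and to obtain
invariance under transposition. -/
theorem map_gaussianMatrix_reindex {d : ℕ} {ι : Type*} [Fintype ι] (e : ι ≃ Fin d × Fin d) :
    (gaussianMatrix d).map (fun Z k => Z (e k).1 (e k).2) =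
      Measure.pi fun _ : ι => gaussianReal 0 1 := by
  refine (Measure.pi_eq fun s hs => ?_).symm
  have hm : Measurable (fun (Z : Matrix (Fin d) (Fin d) ℝ) k => Z (e k).1 (e k).2) :=
    measurable_pi_lambda _ fun k => measurable_matrix_entry _ _
  rw [Measure.map_apply hm (MeasurableSet.univ_pi hs)]
  have hpre : (fun (Z : Matrix (Fin d) (Fin d) ℝ) k => Z (e k).1 (e k).2) ⁻¹' Set.univ.pi s =
      (Set.univ.pi fun i => Set.univ.pi fun j => s (e.symm (i, j)) : Set (Fin d → Fin d → ℝ)) := by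
    ext Z
    constructor
    · intro h i _ j _
      simpa using! h (e.symm (i, j)) trivial
    · intro h k _
      simpa using! h (e k).1 trivial (e k).2 trivial
  rw [hpre, gaussianMatrix]
  refine (Measure.pi_pi _ _).trans ?_
  simp only [Measure.pi_pi]
  rw [← Fintype.prod_prod_type' (f := fun i j => gaussianReal 0 1 (s (e.symm (i, j))))]
  exact e.symm.prod_comp fun k => gaussianReal 0 1 (s k)

theorem ae_isUnit_det_gaussianMatrix (d : ℕ) : ∀ᵐ Z ∂(gaussianMatrix d), IsUnit Z.det := by
  let e : Fin (d * d) ≃ Fin d × Fin d := finProdFinEquiv.symm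
  let p : MvPolynomial (Fin (d * d)) ℝ :=
    MvPolynomial.rename e.symm (Matrix.mvPolynomialX (Fin d) (Fin d) ℝ).det
  have hp : p ≠ 0 := fun h => Matrix.det_mvPolynomialX_ne_zero (Fin d) ℝ
    (MvPolynomial.rename_injective _ e.symm.injective (h.trans (map_zero _).symm))
  have := nullSingletonClass_gaussianReal (μ := 0) one_ne_zero
  have h := ae_eval_mvPolynomial_ne_zero (gaussianReal 0 1) p hp
  rw [← map_gaussianMatrix_reindex e] at h
  filter_upwards [ae_of_ae_map (Measurable.aemeasurable
    (measurable_pi_lambda _ fun k => measurable_matrix_entry _ _)) h] with Z hZ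
  rw [isUnit_iff_ne_zero]
  convert hZ
  rw [MvPolynomial.eval_rename, RingHom.map_det]
  congr 1
  ext i j
  simp [Matrix.mvPolynomialX]

/-! ### Rotation invariance. -/

theorem measurable_transpose {m n : Type*} :
    Measurable (Matrix.transpose : Matrix m n ℝ → Matrix n m ℝ) :=
  measurable_pi_lambda _ fun _ => measurable_pi_lambda _ fun _ => measurable_matrix_entry _ _

theorem map_transpose_gaussianMatrix (d : ℕ) :
    (gaussianMatrix d).map Matrix.transpose = gaussianMatrix d := by
  have h1 := map_gaussianMatrix_reindex (d := d) (Equiv.refl _)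
  have h2 := map_gaussianMatrix_reindex (d := d) (Equiv.prodComm _ _)
  have hc : Measurable (fun (z : Fin d × Fin d → ℝ) => Matrix.of fun i j => z (i, j)) :=
    measurable_pi_lambda _ fun _ => measurable_pi_lambda _ fun _ => measurable_pi_apply _
  have h3 := congrArg (Measure.map fun (z : Fin d × Fin d → ℝ) => Matrix.of fun i j => z (i, j))
    (h2.trans h1.symm)
  rw [Measure.map_map hc (measurable_pi_lambda _ fun _ => measurable_matrix_entry _ _),
    Measure.map_map hc (measurable_pi_lambda _ fun _ => measurable_matrix_entry _ _)] at h3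
  refine h3.trans ?_
  exact Measure.map_id

/-- The matrix whose columns are the images under `L` of the columns of `Z`. -/
noncomputable def mapColumns {d : ℕ}
    (L : EuclideanSpace ℝ (Fin d) ≃ₗᵢ[ℝ] EuclideanSpace ℝ (Fin d))
    (Z : Matrix (Fin d) (Fin d) ℝ) : Matrix (Fin d) (Fin d) ℝ :=
  Matrix.of fun i j => L (column Z j) i

theorem column_mapColumns {d : ℕ}
    (L : EuclideanSpace ℝ (Fin d) ≃ₗᵢ[ℝ] EuclideanSpace ℝ (Fin d))
    (Z : Matrix (Fin d) (Fin d) ℝ) : column (mapColumns L Z) = fun j => L (column Z j) := rfl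

/-- The Gaussian matrix is built as a product over rows, while L acts on columns; hence the
conjugation by transposition. -/
theorem measurePreserving_mapColumns {d : ℕ}
    (L : EuclideanSpace ℝ (Fin d) ≃ₗᵢ[ℝ] EuclideanSpace ℝ (Fin d)) :
    MeasurePreserving (mapColumns L) (gaussianMatrix d) (gaussianMatrix d) := by
  have hL : Measurable fun x : Fin d → ℝ => (L (WithLp.toLp 2 x)).ofLp := by fun_prop
  have hLmap : (Measure.pi fun _ : Fin d => gaussianReal 0 1).map
      (fun x : Fin d → ℝ => (L (WithLp.toLp 2 x)).ofLp) =
      Measure.pi fun _ : Fin d => gaussianReal 0 1 := by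
    have h1 : Measure.map L (stdGaussian (EuclideanSpace ℝ (Fin d))) = stdGaussian _ :=
      stdGaussian_map L
    rw [← map_pi_eq_stdGaussian, Measure.map_map (by fun_prop) (by fun_prop)] at h1
    have h2 := congrArg (Measure.map (WithLp.ofLp : EuclideanSpace ℝ (Fin d) → _)) h1
    rw [Measure.map_map (by fun_prop) (by fun_prop),
      Measure.map_map (by fun_prop) (by fun_prop)] at h2
    exact h2.trans Measure.map_id
  have hT : MeasurePreserving Matrix.transpose (gaussianMatrix d) (gaussianMatrix d) :=
    ⟨measurable_transpose, map_transpose_gaussianMatrix d⟩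
  have hM : MeasurePreserving (fun (Y : Matrix (Fin d) (Fin d) ℝ) j =>
      (L (WithLp.toLp 2 (Y j))).ofLp : _ → Matrix (Fin d) (Fin d) ℝ)
      (gaussianMatrix d) (gaussianMatrix d) :=
    measurePreserving_pi _ _ fun _ => ⟨hL, hLmap⟩
  exact (hT.comp hM).comp hT

theorem gramSchmidt_map {d : ℕ}
    (L : EuclideanSpace ℝ (Fin d) ≃ₗᵢ[ℝ] EuclideanSpace ℝ (Fin d))
    (v : Fin d → EuclideanSpace ℝ (Fin d)) (j : Fin d) :
    InnerProductSpace.gramSchmidt ℝ (fun i => L (v i)) j =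
      L (InnerProductSpace.gramSchmidt ℝ v j) := by
  induction j using WellFoundedLT.induction with
  | ind j ih =>
    rw [InnerProductSpace.gramSchmidt_def, InnerProductSpace.gramSchmidt_def ℝ v j, map_sub,
      map_sum]
    congr 1
    refine Finset.sum_congr rfl fun i hi => ?_
    rw [ih i (Finset.mem_Iio.1 hi)]
    simp only [Submodule.starProjection_singleton, L.inner_map_map, L.norm_map, map_smul]

theorem gramSchmidtNormed_map {d : ℕ}
    (L : EuclideanSpace ℝ (Fin d) ≃ₗᵢ[ℝ] EuclideanSpace ℝ (Fin d))
    (v : Fin d → EuclideanSpace ℝ (Fin d)) (j : Fin d) :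
    InnerProductSpace.gramSchmidtNormed ℝ (fun i => L (v i)) j =
      L (InnerProductSpace.gramSchmidtNormed ℝ v j) := by
  simp only [InnerProductSpace.gramSchmidtNormed, gramSchmidt_map, L.norm_map, map_smul]

/-! ### The Beta law of the projected norm. -/

/-- The squared norm of the projection of `u` to the span of the first `ℓ` columns of the orthogonal
factor of `Z`. -/
noncomputable def projSq {d ℓ : ℕ} (hℓ : ℓ ≤ d) (u : EuclideanSpace ℝ (Fin d))
    (Z : Matrix (Fin d) (Fin d) ℝ) : ℝ :=
  ∑ j : Fin ℓ, (∑ i, qrFactor Z i (Fin.castLE hℓ j) * u i) ^ 2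

theorem projSq_eq {d ℓ : ℕ} (hℓ : ℓ ≤ d) (u : EuclideanSpace ℝ (Fin d))
    (Z : Matrix (Fin d) (Fin d) ℝ) : projSq hℓ u Z = ∑ j : Fin ℓ,
      inner ℝ (InnerProductSpace.gramSchmidtNormed ℝ (column Z) (Fin.castLE hℓ j)) u ^ 2 := by
  simp [projSq, qrFactor, PiLp.inner_apply, mul_comm]

theorem projSq_mapColumns {d ℓ : ℕ} (hℓ : ℓ ≤ d)
    (L : EuclideanSpace ℝ (Fin d) ≃ₗᵢ[ℝ] EuclideanSpace ℝ (Fin d)) (u : EuclideanSpace ℝ (Fin d))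
    (Z : Matrix (Fin d) (Fin d) ℝ) : projSq hℓ (L u) (mapColumns L Z) = projSq hℓ u Z := by
  simp only [projSq_eq, column_mapColumns, gramSchmidtNormed_map, L.inner_map_map]

theorem projSq_smul {d ℓ : ℕ} (hℓ : ℓ ≤ d) (t : ℝ) (u : EuclideanSpace ℝ (Fin d))
    (Z : Matrix (Fin d) (Fin d) ℝ) : projSq hℓ (t • u) Z = t ^ 2 * projSq hℓ u Z := by
  simp only [projSq_eq, inner_smul_right, mul_pow, Finset.mul_sum]

theorem measurable_projSq {d ℓ : ℕ} (hℓ : ℓ ≤ d) :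
    Measurable fun p : EuclideanSpace ℝ (Fin d) × Matrix (Fin d) (Fin d) ℝ =>
      projSq hℓ p.1 p.2 := by
  refine Finset.measurable_sum _ fun j _ => Measurable.pow_const
    (Finset.measurable_sum _ fun i _ => Measurable.mul ?_ ?_) 2
  · exact (measurable_matrix_entry _ _).comp ((measurable_qrFactor d).comp measurable_snd)
  · fun_prop

theorem measurable_projSq_right {d ℓ : ℕ} (hℓ : ℓ ≤ d) (u : EuclideanSpace ℝ (Fin d)) :
    Measurable (projSq hℓ u) := by
  have h := (measurable_projSq hℓ).comp (measurable_prodMk_left (x := u))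
  exact h

/-- Vectors of equal norm are exchanged by a reflection, which preserves the law and commutes with
Gram-Schmidt; homogeneity handles different norms. -/
theorem gaussianMatrix_projSq_const {d ℓ : ℕ} (hℓ : ℓ ≤ d) (c : ℝ)
    {u v : EuclideanSpace ℝ (Fin d)} (hu : u ≠ 0) (hv : v ≠ 0) :
    gaussianMatrix d {Z : Matrix (Fin d) (Fin d) ℝ | c * ‖u‖ ^ 2 ≤ projSq hℓ u Z} =
      gaussianMatrix d {Z | c * ‖v‖ ^ 2 ≤ projSq hℓ v Z} := by
  have hmeas : ∀ w, MeasurableSet {Z | c * ‖w‖ ^ 2 ≤ projSq hℓ w Z} := fun w =>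
    measurableSet_le measurable_const (measurable_projSq_right hℓ w)
  have key : ∀ w w' : EuclideanSpace ℝ (Fin d), ‖w‖ = ‖w'‖ →
      gaussianMatrix d {Z | c * ‖w‖ ^ 2 ≤ projSq hℓ w Z} =
      gaussianMatrix d {Z | c * ‖w'‖ ^ 2 ≤ projSq hℓ w' Z} := by
    intro w w' h
    let L := (Submodule.span ℝ {w - w'})ᗮ.reflection
    have hL : L w = w' := Submodule.reflection_sub h
    rw [← (measurePreserving_mapColumns L).measure_preimage (hmeas w').nullMeasurableSet]
    congr 1
    ext Z
    simp only [Set.mem_preimage, Set.mem_ofPred_eq, ← hL, projSq_mapColumns, L.norm_map]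
  have hu' := norm_pos_iff.2 hu
  have hv' := norm_pos_iff.2 hv
  rw [key v ((‖v‖ / ‖u‖) • u) (by
    rw [norm_smul, Real.norm_of_nonneg (by positivity), div_mul_cancel₀ _ hu'.ne'])]
  congr 1
  ext Z
  have ht : 0 < (‖v‖ / ‖u‖) ^ 2 := by positivity
  simp only [Set.mem_ofPred_eq, projSq_smul, norm_smul, mul_pow, norm_div, norm_norm]
  rw [mul_left_comm, mul_le_mul_iff_right₀ ht]

/-- For ℓ = d the law is the point mass at 1, which is where c ≤ 1 enters. -/
theorem pi_gaussian_truncation {d ℓ : ℕ} (hpos : 1 ≤ ℓ) (hℓ : ℓ ≤ d) {c : ℝ} (hc : c ≤ 1) :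
    (Measure.pi fun _ : Fin d => gaussianReal 0 1)
      {g | c * ∑ i, g i ^ 2 ≤ ∑ j : Fin ℓ, g (Fin.castLE hℓ j) ^ 2} =
      betaLaw ((ℓ : ℝ) / 2) (((d : ℝ) - ℓ) / 2) (Set.Ici c) := by
  rcases hℓ.eq_or_lt with rfl | hlt
  · rw [betaLaw, if_pos (by simp), Measure.dirac_apply' _ measurableSet_Ici,
      Set.indicator_of_mem (show (1 : ℝ) ∈ Set.Ici c from hc), Pi.one_apply,
      ← measure_univ (μ := Measure.pi fun _ : Fin ℓ => gaussianReal 0 1)]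
    congr 1
    refine Set.eq_univ_of_forall fun g => ?_
    change c * ∑ i, g i ^ 2 ≤ ∑ i, g i ^ 2
    exact mul_le_of_le_one_left (Finset.sum_nonneg fun i _ => sq_nonneg _) hc
  · have hb : ((d : ℝ) - ℓ) / 2 ≠ 0 := by
      have : (ℓ : ℝ) < d := Nat.cast_lt.2 hlt
      have : 0 < ((d : ℝ) - ℓ) / 2 := by linarith
      exact this.ne'
    let s : Finset (Fin d) := Finset.univ.map (Fin.castLEEmb hℓ)
    have hs : s.card = ℓ := by simp [s]
    have hsc : sᶜ.card = d - ℓ := by rw [Finset.card_compl, hs, Fintype.card_fin]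
    rw [betaLaw, if_neg hb]
    have h := pi_gaussian_ratio s (Finset.card_pos.1 (by omega)) (Finset.card_pos.1 (by omega)) c
    rw [hs, hsc, Nat.cast_sub hℓ] at h
    rw [← h]
    simp [s]

/-- For invertible Z the Gram-Schmidt vectors form an orthonormal basis, in which the coordinates of
g are again standard normal. -/
theorem stdGaussian_projSq {d ℓ : ℕ} (hpos : 1 ≤ ℓ) (hℓ : ℓ ≤ d) {c : ℝ} (hc : c ≤ 1)
    {Z : Matrix (Fin d) (Fin d) ℝ} (hZ : IsUnit Z.det) :
    stdGaussian (EuclideanSpace ℝ (Fin d)) {g | c * ‖g‖ ^ 2 ≤ projSq hℓ g Z} =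
      betaLaw ((ℓ : ℝ) / 2) (((d : ℝ) - ℓ) / 2) (Set.Ici c) := by
  have hli : LinearIndependent ℝ (column Z) := by
    have h1 : LinearIndependent ℝ Z.col := by
      rw [Matrix.linearIndependent_cols_iff_isUnit, Matrix.isUnit_iff_isUnit_det]
      exact hZ
    exact h1.map' (WithLp.linearEquiv 2 ℝ (Fin d → ℝ)).symm.toLinearMap (LinearEquiv.ker _)
  let b := InnerProductSpace.gramSchmidtOrthonormalBasis
    (𝕜 := ℝ) (E := EuclideanSpace ℝ (Fin d)) (by simp) (column Z)
  have hb : ∀ j, b j = InnerProductSpace.gramSchmidtNormed ℝ (column Z) j := fun j =>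
    InnerProductSpace.gramSchmidtOrthonormalBasis_apply _ (by
      rw [← norm_ne_zero_iff, InnerProductSpace.gramSchmidtNormed_unit_length j hli]
      exact one_ne_zero)
  have hm : MeasurableSet {g : EuclideanSpace ℝ (Fin d) |
      c * ‖g‖ ^ 2 ≤ ∑ j : Fin ℓ, g (Fin.castLE hℓ j) ^ 2} :=
    measurableSet_le (by fun_prop) (by fun_prop)
  have e : {g | c * ‖g‖ ^ 2 ≤ projSq hℓ g Z} = b.repr ⁻¹' {g : EuclideanSpace ℝ (Fin d) |
      c * ‖g‖ ^ 2 ≤ ∑ j : Fin ℓ, g (Fin.castLE hℓ j) ^ 2} := by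
    ext g
    simp only [Set.mem_ofPred_eq, Set.mem_preimage, LinearIsometryEquiv.norm_map, projSq_eq,
      b.repr_apply_apply, hb]
  rw [e, ← Measure.map_apply (by fun_prop) hm, stdGaussian_map, ← map_pi_eq_stdGaussian,
    Measure.map_apply (by fun_prop) hm, ← pi_gaussian_truncation hpos hℓ hc]
  congr 1
  ext g
  simp [EuclideanSpace.real_norm_sq_eq]

theorem stdGaussian_singleton_zero {d : ℕ} (hd : 1 ≤ d) :
    stdGaussian (EuclideanSpace ℝ (Fin d)) {0} = 0 := by
  rw [← map_pi_eq_stdGaussian, Measure.map_apply (by fun_prop) (measurableSet_singleton 0)]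
  have := nullSingletonClass_gaussianReal (μ := 0) one_ne_zero
  have : NullSingletonClass (Measure.pi fun _ : Fin d => gaussianReal 0 1) :=
    Measure.pi_nullSingletonClass (⟨0, hd⟩ : Fin d)
  refine measure_mono_null (t := {0}) (fun g hg => ?_) (measure_singleton _)
  exact (WithLp.toLp_injective 2) hg

/-- The fraction of the squared norm of a fixed vector captured by the first `ℓ` columns of the
orthogonal factor of a Gaussian matrix has a Beta law. -/
theorem gaussianMatrix_projSq {d ℓ : ℕ} (hpos : 1 ≤ ℓ) (hℓ : ℓ ≤ d) {c : ℝ} (hc : c ≤ 1)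
    {u : EuclideanSpace ℝ (Fin d)} (hu : u ≠ 0) :
    gaussianMatrix d {Z | c * ‖u‖ ^ 2 ≤ projSq hℓ u Z} =
      betaLaw ((ℓ : ℝ) / 2) (((d : ℝ) - ℓ) / 2) (Set.Ici c) := by
  have := isProbabilityMeasure_gaussianMatrix d
  -- The same product probability is computed twice: conditioning on g it is the left side,
  -- conditioning on Z the right side.
  let S : Set (EuclideanSpace ℝ (Fin d) × Matrix (Fin d) (Fin d) ℝ) :=
    {p | c * ‖p.1‖ ^ 2 ≤ projSq hℓ p.1 p.2}
  have hS : MeasurableSet S := measurableSet_le (by fun_prop) (measurable_projSq hℓ)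
  have h1 : ((stdGaussian (EuclideanSpace ℝ (Fin d))).prod (gaussianMatrix d)) S =
      gaussianMatrix d {Z | c * ‖u‖ ^ 2 ≤ projSq hℓ u Z} := by
    rw [Measure.prod_apply hS]
    have : ∀ᵐ g ∂(stdGaussian (EuclideanSpace ℝ (Fin d))), gaussianMatrix d (Prod.mk g ⁻¹' S) =
        gaussianMatrix d {Z | c * ‖u‖ ^ 2 ≤ projSq hℓ u Z} := by
      filter_upwards [compl_mem_ae_iff.2 (stdGaussian_singleton_zero (hpos.trans hℓ))] with g hg
      exact gaussianMatrix_projSq_const hℓ c hg hu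
    rw [lintegral_congr_ae this, lintegral_const, measure_univ, mul_one]
  have h2 : ((stdGaussian (EuclideanSpace ℝ (Fin d))).prod (gaussianMatrix d)) S =
      betaLaw ((ℓ : ℝ) / 2) (((d : ℝ) - ℓ) / 2) (Set.Ici c) := by
    rw [Measure.prod_apply_symm hS]
    have : ∀ᵐ Z ∂(gaussianMatrix d),
        stdGaussian (EuclideanSpace ℝ (Fin d)) ((fun g => (g, Z)) ⁻¹' S) =
        betaLaw ((ℓ : ℝ) / 2) (((d : ℝ) - ℓ) / 2) (Set.Ici c) := by
      filter_upwards [ae_isUnit_det_gaussianMatrix d] with Z hZ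
      exact stdGaussian_projSq hpos hℓ hc hZ
    rw [lintegral_congr_ae this, lintegral_const, measure_univ, mul_one]
  rw [← h1, h2]

/-! ### The random sketch and one descent step. -/

theorem measurable_sum_transpose_mulVec_sq {d ℓ : ℕ} :
    Measurable fun p : EuclideanSpace ℝ (Fin d) × Matrix (Fin d) (Fin ℓ) ℝ =>
      ∑ j, p.2.transpose.mulVec p.1.ofLp j ^ 2 := by
  simp only [Matrix.mulVec, dotProduct, Matrix.transpose_apply]
  refine Finset.measurable_sum _ fun j _ => Measurable.pow_const
    (Finset.measurable_sum _ fun i _ => Measurable.mul ?_ ?_) 2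
  · exact (measurable_matrix_entry _ _).comp measurable_snd
  · fun_prop

theorem measurable_sum_transpose_mulVec_sq_right {d ℓ : ℕ} (u : EuclideanSpace ℝ (Fin d)) :
    Measurable fun P : Matrix (Fin d) (Fin ℓ) ℝ => ∑ j, P.transpose.mulVec u.ofLp j ^ 2 := by
  have h := measurable_sum_transpose_mulVec_sq.comp
    (measurable_prodMk_left (β := Matrix (Fin d) (Fin ℓ) ℝ) (x := u))
  exact h

/-- The scaling √(d/ℓ) turns the threshold 1 - ε into (1 - ε)ℓ/d for the Beta variable. -/
theorem haarLaw_real_eq {d ℓ : ℕ} (hpos : 1 ≤ ℓ) (hℓ : ℓ ≤ d) {ε : ℝ} (hε0 : 0 < ε)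
    {u : EuclideanSpace ℝ (Fin d)} (hu : u ≠ 0) :
    (haarLaw hℓ).real {P | (1 - ε) * ‖u‖ ^ 2 ≤ ∑ j, P.transpose.mulVec u.ofLp j ^ 2} =
      embeddingProb d ℓ ε := by
  have hl : (0 : ℝ) < ℓ := Nat.cast_pos.2 hpos
  have hd : (0 : ℝ) < d := Nat.cast_pos.2 (hpos.trans hℓ)
  have hld : (ℓ : ℝ) ≤ d := Nat.cast_le.2 hℓ
  have hc : (1 - ε) * ℓ / d ≤ 1 := by
    rw [div_le_one hd]
    nlinarith
  have hm : MeasurableSet {P : Matrix (Fin d) (Fin ℓ) ℝ |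
      (1 - ε) * ‖u‖ ^ 2 ≤ ∑ j, P.transpose.mulVec u.ofLp j ^ 2} :=
    measurableSet_le measurable_const
      (measurable_sum_transpose_mulVec_sq_right u)
  rw [embeddingProb, measureReal_def, measureReal_def, ← gaussianMatrix_projSq hpos hℓ hc hu,
    haarLaw, Measure.map_apply (measurable_scaledTruncation hℓ) hm]
  congr 2
  ext Z
  have e : ∑ j, (scaledTruncation hℓ Z).transpose.mulVec u.ofLp j ^ 2 =
      (d : ℝ) / ℓ * projSq hℓ u Z := by
    have hs : Real.sqrt ((d : ℝ) / ℓ) ^ 2 = (d : ℝ) / ℓ := Real.sq_sqrt (by positivity)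
    rw [projSq, Finset.mul_sum]
    refine Finset.sum_congr rfl fun j _ => ?_
    rw [← hs, ← mul_pow, Finset.mul_sum, Matrix.mulVec, dotProduct]
    refine congrArg (· ^ 2) (Finset.sum_congr rfl fun i _ => ?_)
    simp [scaledTruncation, mul_assoc]
  simp only [Set.mem_preimage, Set.mem_ofPred_eq, e]
  rw [div_mul_eq_mul_div, div_mul_eq_mul_div, div_le_iff₀ hd, le_div_iff₀ hl]
  constructor <;> intro h <;> linarith

theorem ae_haarLaw_transpose_mul_self {d ℓ : ℕ} (hℓ : ℓ ≤ d) :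
    ∀ᵐ P ∂(haarLaw hℓ), P.transpose * P = ((d : ℝ) / ℓ) • (1 : Matrix (Fin ℓ) (Fin ℓ) ℝ) := by
  have hm : MeasurableSet {P : Matrix (Fin d) (Fin ℓ) ℝ |
      P.transpose * P = ((d : ℝ) / ℓ) • (1 : Matrix (Fin ℓ) (Fin ℓ) ℝ)} := by
    simp only [← Matrix.ext_iff, Set.ofPred_forall, Matrix.mul_apply, Matrix.transpose_apply]
    refine MeasurableSet.iInter fun i => MeasurableSet.iInter fun j =>
      measurableSet_eq_fun ?_ measurable_const
    exact Finset.measurable_sum _ fun k _ =>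
      (measurable_matrix_entry k i).mul (measurable_matrix_entry k j)
  rw [haarLaw, ae_map_iff (measurable_scaledTruncation hℓ).aemeasurable hm]
  filter_upwards [ae_isUnit_det_gaussianMatrix d] with Z hZ
  have hQ := (Matrix.mem_orthogonalGroup_iff' (Fin d) ℝ).1 (qrFactor_spec Z hZ).1
  have hs : Real.sqrt ((d : ℝ) / ℓ) * Real.sqrt ((d : ℝ) / ℓ) = (d : ℝ) / ℓ :=
    Real.mul_self_sqrt (by positivity)
  rw [scaledTruncation, Matrix.transpose_smul, Matrix.smul_mul, Matrix.mul_smul, smul_smul, hs]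
  congr 1
  ext i j
  have := congrFun (congrFun hQ (Fin.castLE hℓ i)) (Fin.castLE hℓ j)
  simpa [Matrix.mul_apply, Matrix.one_apply, Matrix.star_apply] using this

/-- One step of the subspace descent method with step size `a` and direction matrix `P`. -/
noncomputable def descentStep {d ℓ : ℕ} (f : EuclideanSpace ℝ (Fin d) → ℝ) (a : ℝ)
    (x : EuclideanSpace ℝ (Fin d)) (P : Matrix (Fin d) (Fin ℓ) ℝ) : EuclideanSpace ℝ (Fin d) :=
  x - a • WithLp.toLp 2 ((P * P.transpose).mulVec (gradient f x).ofLp)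

theorem measurable_descentStep {d ℓ : ℕ} {f : EuclideanSpace ℝ (Fin d) → ℝ}
    (hf : Continuous (gradient f)) (a : ℝ) :
    Measurable fun p : EuclideanSpace ℝ (Fin d) × Matrix (Fin d) (Fin ℓ) ℝ =>
      descentStep f a p.1 p.2 := by
  have hg : Measurable fun p : EuclideanSpace ℝ (Fin d) × Matrix (Fin d) (Fin ℓ) ℝ =>
      gradient f p.1 := hf.measurable.comp measurable_fst
  refine measurable_fst.sub (Measurable.const_smul ?_ a)
  refine (PiLp.continuous_toLp 2 _).measurable.comp (measurable_pi_lambda _ fun i => ?_)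
  simp only [Matrix.mulVec, dotProduct, Matrix.mul_apply, Matrix.transpose_apply]
  refine Finset.measurable_sum _ fun j _ => Measurable.mul
    (Finset.measurable_sum _ fun l _ => Measurable.mul ?_ ?_) ?_
  · exact (measurable_matrix_entry _ _).comp measurable_snd
  · exact (measurable_matrix_entry _ _).comp measurable_snd
  · exact (measurable_pi_apply j).comp ((PiLp.continuous_ofLp 2 _).measurable.comp hg)

/-- The hypothesis on P gives ‖PPᵀg‖² = (d/ℓ)‖Pᵀg‖², so the descent lemma yields (-α +
α²λd/(2ℓ))‖Pᵀg‖², which the chosen step size minimises. -/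
theorem apply_descentStep_le {d ℓ : ℕ} (hpos : 1 ≤ ℓ) (hℓ : ℓ ≤ d)
    {f : EuclideanSpace ℝ (Fin d) → ℝ} (hf : Differentiable ℝ f) {lam : NNReal} (hlam : 0 < lam)
    (hlip : LipschitzWith lam (gradient f)) (x : EuclideanSpace ℝ (Fin d))
    {P : Matrix (Fin d) (Fin ℓ) ℝ}
    (hP : P.transpose * P = ((d : ℝ) / ℓ) • (1 : Matrix (Fin ℓ) (Fin ℓ) ℝ)) :
    f (descentStep f ((ℓ : ℝ) / (d * lam)) x P) ≤ f x - (ℓ : ℝ) / (d * lam) / 2 *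
      ∑ j, P.transpose.mulVec (gradient f x).ofLp j ^ 2 := by
  have hl : (0 : ℝ) < ℓ := Nat.cast_pos.2 hpos
  have hd : (0 : ℝ) < d := Nat.cast_pos.2 (hpos.trans hℓ)
  have hlam' : (0 : ℝ) < lam := hlam
  set g := gradient f x with hg
  set w := P.transpose.mulVec g.ofLp with hw
  have hS : ∑ j, w j ^ 2 = w ⬝ᵥ w := by simp [dotProduct, sq]
  have hPw : (P * P.transpose).mulVec g.ofLp = P.mulVec w := by
    rw [hw, Matrix.mulVec_mulVec]
  have hin : inner ℝ g (WithLp.toLp 2 (P.mulVec w)) = w ⬝ᵥ w := by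
    rw [EuclideanSpace.inner_eq_star_dotProduct, star_trivial, dotProduct_comm,
      Matrix.dotProduct_mulVec, ← Matrix.mulVec_transpose]
  have hnorm : ‖(WithLp.toLp 2 (P.mulVec w) : EuclideanSpace ℝ (Fin d))‖ ^ 2 =
      (d : ℝ) / ℓ * (w ⬝ᵥ w) := by
    rw [← real_inner_self_eq_norm_sq, EuclideanSpace.inner_eq_star_dotProduct, star_trivial,
      Matrix.dotProduct_mulVec, ← Matrix.mulVec_transpose, Matrix.mulVec_mulVec, hP,
      Matrix.smul_mulVec, Matrix.one_mulVec, smul_dotProduct, smul_eq_mul]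
  have h := le_add_inner_gradient_add_sq hf hlip x
    (-(((ℓ : ℝ) / (d * lam)) • WithLp.toLp 2 (P.mulVec w)))
  rw [← sub_eq_add_neg, inner_neg_right, inner_smul_right, norm_neg, norm_smul, mul_pow, ← hg,
    hin, hnorm, Real.norm_eq_abs, sq_abs] at h
  rw [descentStep, ← hg, hPw, hS]
  refine h.trans (le_of_eq ?_)
  field_simp
  ring

/-- The contraction factor of a step whose sketched gradient keeps a fraction `1 - ε` of the squared
norm of the gradient. -/
noncomputable def contractionFactor (d ℓ : ℕ) (lam γ ε : ℝ) : ℝ :=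
  1 - (1 - ε) * ((ℓ : ℝ) * γ / (d * lam))

theorem contractionFactor_mem_Ioo {d ℓ : ℕ} (hpos : 1 ≤ ℓ) (hℓ : ℓ ≤ d) {lam γ ε : ℝ}
    (hγ : 0 < γ) (hle : γ ≤ lam) (hε0 : 0 < ε) (hε1 : ε < 1) :
    contractionFactor d ℓ lam γ ε ∈ Set.Ioo 0 1 := by
  have hl : (0 : ℝ) < ℓ := Nat.cast_pos.2 hpos
  have hd : (0 : ℝ) < d := Nat.cast_pos.2 (hpos.trans hℓ)
  have hld : (ℓ : ℝ) ≤ d := Nat.cast_le.2 hℓ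
  have hlam : 0 < lam := hγ.trans_le hle
  have h1 : (ℓ : ℝ) * γ / (d * lam) ≤ 1 := by
    rw [div_le_one (by positivity)]
    exact mul_le_mul hld hle hγ.le hd.le
  have h2 : 0 < (ℓ : ℝ) * γ / (d * lam) := by positivity
  constructor <;> unfold contractionFactor <;> nlinarith

/-! ### Recursion for moments of the gap. -/

section Recursion

variable {d ℓ : ℕ} {f : EuclideanSpace ℝ (Fin d) → ℝ} {lam : NNReal} {γ fstar ε δ : ℝ}

/-- On the good event the gap is multiplied by at most r, elsewhere by at most 1. As r^θ ≤ 1,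
replacing the true probability of the good event by the smaller δ only weakens the bound. -/
theorem lintegral_gap_descentStep_le (hpos : 1 ≤ ℓ) (hℓ : ℓ ≤ d) (hf : Differentiable ℝ f)
    (hlip : LipschitzWith lam (gradient f)) (hmin : IsLeast (Set.range f) fstar) (hγ : 0 < γ)
    (hconv : StrongConvexOn Set.univ γ f) (hle : γ ≤ lam) (hε0 : 0 < ε) (hε1 : ε < 1)
    (hδ1 : δ < 1) (hδ : δ ≤ embeddingProb d ℓ ε) {θ : ℝ} (hθ : 0 < θ)
    (x : EuclideanSpace ℝ (Fin d)) :
    ∫⁻ P, ENNReal.ofReal ((f (descentStep f ((ℓ : ℝ) / (d * lam)) x P) - fstar) ^ θ) ∂(haarLaw hℓ) ≤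
      ENNReal.ofReal (1 - δ + δ * contractionFactor d ℓ lam γ ε ^ θ) *
        ENNReal.ofReal ((f x - fstar) ^ θ) := by
  have := isProbabilityMeasure_haarLaw hℓ
  have hgap : ∀ y, 0 ≤ f y - fstar := fun y => sub_nonneg.2 (hmin.2 (Set.mem_range_self y))
  have hl : (0 : ℝ) < ℓ := Nat.cast_pos.2 hpos
  have hd : (0 : ℝ) < d := Nat.cast_pos.2 (hpos.trans hℓ)
  have hlam : (0 : ℝ) < lam := hγ.trans_le hle
  obtain ⟨hr0, hr1⟩ := contractionFactor_mem_Ioo hpos hℓ hγ hle hε0 hε1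
  set r := contractionFactor d ℓ lam γ ε with hr
  have hrθ0 : 0 < r ^ θ := Real.rpow_pos_of_pos hr0 θ
  have hrθ1 : r ^ θ ≤ 1 := Real.rpow_le_one hr0.le hr1.le hθ.le
  set V := (f x - fstar) ^ θ with hV
  have hV0 : 0 ≤ V := Real.rpow_nonneg (hgap x) θ
  set G : Set (Matrix (Fin d) (Fin ℓ) ℝ) :=
    {P | (1 - ε) * ‖gradient f x‖ ^ 2 ≤ ∑ j, P.transpose.mulVec (gradient f x).ofLp j ^ 2} with hG
  have hGm : MeasurableSet G :=
    measurableSet_le measurable_const (measurable_sum_transpose_mulVec_sq_right _)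
  have hGp : δ ≤ (haarLaw hℓ).real G := by
    -- The Beta law needs a nonzero vector; at a zero gradient the good event is everything.
    by_cases hg : gradient f x = 0
    · have : G = Set.univ := Set.eq_univ_of_forall fun P => by
        simp only [hG, Set.mem_ofPred_eq, hg, norm_zero]
        simp only [ne_eq, OfNat.ofNat_ne_zero, not_false_eq_true, zero_pow, mul_zero]
        exact Finset.sum_nonneg fun j _ => sq_nonneg _
      rw [this, probReal_univ]
      exact hδ1.le
    · rw [hG, haarLaw_real_eq hpos hℓ hε0 hg]
      exact hδ
  have hpt : ∀ᵐ P ∂(haarLaw hℓ),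
      ENNReal.ofReal ((f (descentStep f ((ℓ : ℝ) / (d * lam)) x P) - fstar) ^ θ) ≤
        G.indicator (fun _ => ENNReal.ofReal (V * r ^ θ)) P +
          Gᶜ.indicator (fun _ => ENNReal.ofReal V) P := by
    filter_upwards [ae_haarLaw_transpose_mul_self hℓ] with P hP
    have hdec := apply_descentStep_le hpos hℓ hf (NNReal.coe_pos.1 hlam) hlip x hP
    have hα : 0 < (ℓ : ℝ) / (d * lam) := by positivity
    by_cases hPG : P ∈ G
    · rw [Set.indicator_of_mem hPG, Set.indicator_of_notMem (by simpa using hPG), add_zero, hV,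
        ← Real.mul_rpow (hgap x) hr0.le]
      refine ENNReal.ofReal_le_ofReal (Real.rpow_le_rpow (hgap _) ?_ hθ.le)
      have hPL : 2 * γ * (f x - fstar) ≤ ‖gradient f x‖ ^ 2 := by
        obtain ⟨y, hy⟩ := hmin.1
        rw [← hy]
        exact two_mul_sub_le_norm_gradient_sq hf hγ hconv x y
      have hPG' : (1 - ε) * ‖gradient f x‖ ^ 2 ≤
        ∑ j, P.transpose.mulVec (gradient f x).ofLp j ^ 2 := hPG
      have h1 : (1 - ε) * (2 * γ * (f x - fstar)) ≤
          ∑ j, P.transpose.mulVec (gradient f x).ofLp j ^ 2 :=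
        (mul_le_mul_of_nonneg_left hPL (by linarith)).trans hPG'
      have h2 := mul_le_mul_of_nonneg_left h1 (half_pos hα).le
      have h3 : (f x - fstar) * r =
          f x - fstar - (ℓ : ℝ) / (d * lam) / 2 * ((1 - ε) * (2 * γ * (f x - fstar))) := by
        rw [hr, contractionFactor]
        ring
      linarith
    · rw [Set.indicator_of_notMem hPG, Set.indicator_of_mem (by simpa using hPG), zero_add, hV]
      refine ENNReal.ofReal_le_ofReal (Real.rpow_le_rpow (hgap _) ?_ hθ.le)
      have h1 : 0 ≤ ∑ j, P.transpose.mulVec (gradient f x).ofLp j ^ 2 :=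
        Finset.sum_nonneg fun j _ => sq_nonneg _
      have h2 := mul_nonneg (half_pos hα).le h1
      linarith
  refine (lintegral_mono_ae hpt).trans ?_
  rw [lintegral_add_left (measurable_const.indicator hGm), lintegral_indicator_const hGm,
    lintegral_indicator_const hGm.compl, ← ofReal_measureReal, ← ofReal_measureReal,
    probReal_compl_eq_one_sub hGm]
  have hp1 : (haarLaw hℓ).real G ≤ 1 := measureReal_le_one
  have hp0 : 0 ≤ (haarLaw hℓ).real G := measureReal_nonneg
  rw [← ENNReal.ofReal_mul (by positivity), ← ENNReal.ofReal_mul hV0,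
    ← ENNReal.ofReal_add (by positivity) (mul_nonneg hV0 (by linarith)),
    ← ENNReal.ofReal_mul' hV0]
  refine ENNReal.ofReal_le_ofReal ?_
  have h4 : 0 ≤ V * (((haarLaw hℓ).real G - δ) * (1 - r ^ θ)) :=
    mul_nonneg hV0 (mul_nonneg (by linarith) (by linarith))
  nlinarith

variable {Ω : Type*} {P : ℕ → Ω → Matrix (Fin d) (Fin ℓ) ℝ} {x₀ : EuclideanSpace ℝ (Fin d)}
  {x : ℕ → Ω → EuclideanSpace ℝ (Fin d)}

/-- Each iterate depends only on earlier matrices, which gives its independence from the current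
one. -/
theorem exists_measurable_iterate (hf : Continuous (gradient f)) (a : ℝ)
    (hx_zero : ∀ ω, x 0 ω = x₀) (hx_succ : ∀ j ω, x (j + 1) ω = descentStep f a (x j ω) (P j ω))
    (j : ℕ) :
    ∃ F : (Finset.range j → Matrix (Fin d) (Fin ℓ) ℝ) → EuclideanSpace ℝ (Fin d),
      Measurable F ∧ ∀ ω, x j ω = F fun i => P i ω := by
  induction j with
  | zero => exact ⟨fun _ => x₀, measurable_const, hx_zero⟩
  | succ j ih =>
    obtain ⟨F, hF, hxF⟩ := ih
    refine ⟨fun h => descentStep f a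
      (F fun i => h ⟨i, Finset.mem_range.2 ((Finset.mem_range.1 i.2).trans j.lt_succ_self)⟩)
      (h ⟨j, Finset.self_mem_range_succ j⟩), ?_, fun ω => ?_⟩
    · refine (measurable_descentStep hf a).comp (Measurable.prodMk (hF.comp ?_) ?_)
      · exact measurable_pi_lambda _ fun i => measurable_pi_apply _
      · exact measurable_pi_apply _
    · rw [hx_succ, hxF]

variable [MeasurableSpace Ω] {μ : Measure Ω} [IsProbabilityMeasure μ]

theorem map_iterate_prod_eq (hℓ : ℓ ≤ d) (hf : Continuous (gradient f)) (a : ℝ)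
    (hP_indep : iIndepFun P μ) (hP_law : ∀ k, HasLaw (P k) (haarLaw hℓ) μ)
    (hx_zero : ∀ ω, x 0 ω = x₀) (hx_succ : ∀ j ω, x (j + 1) ω = descentStep f a (x j ω) (P j ω))
    (j : ℕ) :
    AEMeasurable (x j) μ ∧
      μ.map (fun ω => (x j ω, P j ω)) = (μ.map (x j)).prod (haarLaw hℓ) := by
  obtain ⟨F, hF, hxF⟩ := exists_measurable_iterate hf a hx_zero hx_succ j
  have hPm : ∀ k, AEMeasurable (P k) μ := fun k => (hP_law k).aemeasurable
  have hxe : x j = F ∘ fun ω (i : Finset.range j) => P i ω := funext hxF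
  have hxm : AEMeasurable (x j) μ := by
    rw [hxe]
    exact hF.comp_aemeasurable (aemeasurable_pi_lambda _ fun i => hPm i)
  refine ⟨hxm, ?_⟩
  have h1 := (hP_indep.indepFun_finset₀ (Finset.range j) {j} (by simp) hPm).comp hF
    (measurable_pi_apply (⟨j, Finset.mem_singleton_self j⟩ : ({j} : Finset ℕ)))
  have h2 : IndepFun (x j) (P j) μ := by
    rw [hxe]
    exact h1
  rw [(indepFun_iff_map_prod_eq_prod_map_map hxm (hPm j)).1 h2, (hP_law j).map_eq]

theorem lintegral_gap_iterate_le (hpos : 1 ≤ ℓ) (hℓ : ℓ ≤ d) (hf : Differentiable ℝ f)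
    (hlip : LipschitzWith lam (gradient f)) (hmin : IsLeast (Set.range f) fstar) (hγ : 0 < γ)
    (hconv : StrongConvexOn Set.univ γ f) (hle : γ ≤ lam) (hε0 : 0 < ε) (hε1 : ε < 1)
    (hδ1 : δ < 1) (hδ : δ ≤ embeddingProb d ℓ ε) {θ : ℝ} (hθ : 0 < θ)
    (hP_indep : iIndepFun P μ) (hP_law : ∀ k, HasLaw (P k) (haarLaw hℓ) μ)
    (hx_zero : ∀ ω, x 0 ω = x₀)
    (hx_succ : ∀ j ω, x (j + 1) ω = descentStep f ((ℓ : ℝ) / (d * lam)) (x j ω) (P j ω)) (k : ℕ) :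
    ∫⁻ ω, ENNReal.ofReal ((f (x k ω) - fstar) ^ θ) ∂μ ≤
      ENNReal.ofReal (1 - δ + δ * contractionFactor d ℓ lam γ ε ^ θ) ^ k *
        ENNReal.ofReal ((f x₀ - fstar) ^ θ) := by
  have := isProbabilityMeasure_haarLaw hℓ
  induction k with
  | zero => simp [hx_zero]
  | succ k ih =>
    obtain ⟨hxm, hmap⟩ := map_iterate_prod_eq hℓ hlip.continuous _ hP_indep hP_law hx_zero hx_succ k
    have hgap : Measurable fun y => ENNReal.ofReal ((f y - fstar) ^ θ) := by
      have := hf.continuous.measurable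
      fun_prop
    have hΨ : Measurable fun p : EuclideanSpace ℝ (Fin d) × Matrix (Fin d) (Fin ℓ) ℝ =>
        ENNReal.ofReal ((f (descentStep f ((ℓ : ℝ) / (d * lam)) p.1 p.2) - fstar) ^ θ) :=
      hgap.comp (measurable_descentStep hlip.continuous _)
    calc ∫⁻ ω, ENNReal.ofReal ((f (x (k + 1) ω) - fstar) ^ θ) ∂μ
        = ∫⁻ p, ENNReal.ofReal ((f (descentStep f ((ℓ : ℝ) / (d * lam)) p.1 p.2) - fstar) ^ θ)
            ∂(μ.map fun ω => (x k ω, P k ω)) := by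
          rw [lintegral_map' hΨ.aemeasurable (hxm.prodMk (hP_law k).aemeasurable)]
          simp only [hx_succ]
      _ = ∫⁻ y, ∫⁻ Q, ENNReal.ofReal
            ((f (descentStep f ((ℓ : ℝ) / (d * lam)) y Q) - fstar) ^ θ) ∂(haarLaw hℓ)
            ∂(μ.map (x k)) := by
          rw [hmap, lintegral_prod _ hΨ.aemeasurable]
      _ ≤ ∫⁻ y, ENNReal.ofReal (1 - δ + δ * contractionFactor d ℓ lam γ ε ^ θ) *
            ENNReal.ofReal ((f y - fstar) ^ θ) ∂(μ.map (x k)) :=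
          lintegral_mono fun y => lintegral_gap_descentStep_le hpos hℓ hf hlip hmin hγ hconv hle
            hε0 hε1 hδ1 hδ hθ y
      _ = ENNReal.ofReal (1 - δ + δ * contractionFactor d ℓ lam γ ε ^ θ) *
            ∫⁻ ω, ENNReal.ofReal ((f (x k ω) - fstar) ^ θ) ∂μ := by
          rw [lintegral_const_mul _ hgap, lintegral_map' hgap.aemeasurable hxm]
      _ ≤ _ := by
          rw [pow_succ', mul_assoc]
          gcongr

end Recursion

/-! ### Chernoff bound and conclusion. -/

/-- The Chernoff bound for a Bernoulli law, optimised with its sub-Gaussian proxy variance. -/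
theorem chernoff_bernoulli_le {δ t s : ℝ} (hδ0 : 0 < δ) (hδ1 : δ < 1) (k : ℕ)
    (hs : s = t / proxyVariance 1 δ) :
    Real.exp (s * (δ - t) * k) * (1 - δ + δ * Real.exp (-s)) ^ k ≤
      Real.exp (-(k * t) ^ 2 / (2 * proxyVariance k δ)) := by
  have hv := proxyVariance_one_pos hδ0 hδ1
  have hmgf := bernoulli_mgf_le hδ0 hδ1 s
  rw [proxyVariance_eq_mul k δ]
  set v := proxyVariance 1 δ
  have hq : 0 ≤ 1 - δ + δ * Real.exp (-s) := by
    have : 0 < 1 - δ := by linarith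
    positivity
  calc Real.exp (s * (δ - t) * k) * (1 - δ + δ * Real.exp (-s)) ^ k
      = (Real.exp (-(s * t)) * (Real.exp (s * δ) * (1 - δ + δ * Real.exp (-s)))) ^ k := by
        rw [← mul_assoc, ← Real.exp_add, mul_pow, ← Real.exp_nat_mul]
        ring_nf
    _ ≤ (Real.exp (-(s * t)) * Real.exp (s ^ 2 * v / 2)) ^ k := by gcongr
    -- The choice s = t/v minimises -st + s²v/2, with value -t²/(2v).
    _ = Real.exp (-(k * t) ^ 2 / (2 * (k * v))) := by
        rw [← Real.exp_add, ← Real.exp_nat_mul, hs]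
        congr 1
        rcases eq_or_ne (k : ℝ) 0 with hk | hk
        · simp [hk]
        · field_simp
          ring

end SubspaceDescent

theorem theorem4 {Ω : Type*} [MeasurableSpace Ω] (μ : Measure Ω) [IsProbabilityMeasure μ]
    (d ℓ : ℕ) (hℓ_pos : 1 ≤ ℓ) (hℓ : ℓ ≤ d)
    (f : EuclideanSpace ℝ (Fin d) → ℝ) (lam : NNReal) (γ fstar : ℝ)
    (hf_diff : ContDiff ℝ 1 f)
    (hf_lip : LipschitzWith lam (gradient f))
    (hf_min : IsLeast (Set.range f) fstar)
    (hγ : 0 < γ)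
    (hf_conv : StrongConvexOn Set.univ γ f)
    (ε : ℝ) (hε_pos : 0 < ε) (hε_lt : ε < 1)
    (δ : ℝ) (hδ_pos : 0 < δ) (hδ_lt : δ < 1)
    (hδ : δ ≤ SubspaceDescent.embeddingProb d ℓ ε)
    (P : ℕ → Ω → Matrix (Fin d) (Fin ℓ) ℝ)
    (hP_indep : iIndepFun P μ)
    (hP_law : ∀ k, HasLaw (P k) (SubspaceDescent.haarLaw hℓ) μ)
    (x₀ : EuclideanSpace ℝ (Fin d)) (hx₀ : fstar < f x₀)
    (x : ℕ → Ω → EuclideanSpace ℝ (Fin d))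
    (hx_zero : ∀ ω, x 0 ω = x₀)
    (hx_succ : ∀ j ω, x (j + 1) ω = x j ω - ((ℓ : ℝ) / (d * lam)) •
      WithLp.toLp 2 ((P j ω * (P j ω).transpose).mulVec (gradient f (x j ω)).ofLp))
    (k : ℕ) (hk : 1 ≤ k)
    (t : ℝ) (ht_pos : 0 < t) (ht_le : t ≤ δ)
    (ρ : ℝ) (hρ : ρ = (1 - (1 - ε) * ((ℓ : ℝ) * γ / (d * lam))) ^ (δ - t)) :
    μ.real {ω | ρ ^ k * (f x₀ - fstar) ≤ f (x k ω) - fstar} ≤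
      Real.exp (-(k * t) ^ 2 / (2 * SubspaceDescent.proxyVariance k δ)) := by
  have hf : Differentiable ℝ f := hf_diff.differentiable one_ne_zero
  have : Nonempty (Fin d) := ⟨⟨0, hℓ_pos.trans hℓ⟩⟩
  have hle : γ ≤ lam := SubspaceDescent.strongConvexOn_modulus_le_lipschitz hf hf_lip hf_conv
  have hr := SubspaceDescent.contractionFactor_mem_Ioo hℓ_pos hℓ hγ hle hε_pos hε_lt
  have hv := SubspaceDescent.proxyVariance_one_pos hδ_pos hδ_lt
  have hρ' : ρ = SubspaceDescent.contractionFactor d ℓ lam γ ε ^ (δ - t) := hρ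
  set s := t / SubspaceDescent.proxyVariance 1 δ with hs
  have hs0 : 0 < s := div_pos ht_pos hv
  have hE := fun θ hθ => SubspaceDescent.lintegral_gap_iterate_le (θ := θ) hℓ_pos hℓ hf hf_lip hf_min
    hγ hf_conv hle hε_pos hε_lt hδ_lt hδ hθ hP_indep hP_law hx_zero hx_succ k
  obtain ⟨hxm, -⟩ := SubspaceDescent.map_iterate_prod_eq hℓ hf_lip.continuous _ hP_indep hP_law
    hx_zero hx_succ k
  set r := SubspaceDescent.contractionFactor d ℓ lam γ ε
  have hlog : Real.log r < 0 := Real.log_neg hr.1 hr.2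
  -- Chosen so that r^θ = e^{-s}, which turns the moment recursion into a Bernoulli moment
  -- generating function.
  set θ := s / -Real.log r with hθ
  have hθ0 : 0 < θ := div_pos hs0 (neg_pos.2 hlog)
  have hlogθ : Real.log r * θ = -s := by
    have := hlog.ne
    rw [hθ]
    field_simp
  have hrθ : r ^ θ = Real.exp (-s) := by rw [Real.rpow_def_of_pos hr.1, hlogθ]
  have hρk : (ρ ^ k) ^ θ = Real.exp (-(s * (δ - t) * k)) := by
    rw [hρ', ← Real.rpow_natCast, ← Real.rpow_mul hr.1.le, ← Real.rpow_mul hr.1.le,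
      Real.rpow_def_of_pos hr.1]
    congr 1
    linear_combination (δ - t) * k * hlogθ
  have hρ0 : 0 < ρ := hρ' ▸ Real.rpow_pos_of_pos hr.1 _
  have hgap₀ : 0 < f x₀ - fstar := sub_pos.2 hx₀
  have hE' := hE θ hθ0
  rw [hrθ] at hE'
  have hq : 0 ≤ 1 - δ + δ * Real.exp (-s) := by
    have : 0 < 1 - δ := by linarith
    positivity
  have hV₀ : 0 < (f x₀ - fstar) ^ θ := Real.rpow_pos_of_pos hgap₀ θ
  rw [← ENNReal.ofReal_pow hq, ← ENNReal.ofReal_mul (pow_nonneg hq k)] at hE'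
  -- The Markov threshold for gap^θ; the power of the initial gap cancels in the quotient.
  set B := (ρ ^ k * (f x₀ - fstar)) ^ θ with hB
  have hBeq : B = Real.exp (-(s * (δ - t) * k)) * (f x₀ - fstar) ^ θ := by
    rw [hB, Real.mul_rpow (pow_nonneg hρ0.le k) hgap₀.le, hρk]
  have hB0 : 0 < B := by rw [hBeq]; positivity
  have hmeas : AEMeasurable (fun ω => ENNReal.ofReal ((f (x k ω) - fstar) ^ θ)) μ := by
    have := hf.continuous.measurable
    fun_prop
  have hsub : {ω | ρ ^ k * (f x₀ - fstar) ≤ f (x k ω) - fstar} ⊆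
      {ω | ENNReal.ofReal B ≤ ENNReal.ofReal ((f (x k ω) - fstar) ^ θ)} := fun ω hω =>
    ENNReal.ofReal_le_ofReal (Real.rpow_le_rpow (by positivity) hω hθ0.le)
  have hmarkov := (measure_mono hsub).trans (meas_ge_le_lintegral_div hmeas
    (ENNReal.ofReal_pos.2 hB0).ne' ENNReal.ofReal_ne_top)
  have hbound : μ {ω | ρ ^ k * (f x₀ - fstar) ≤ f (x k ω) - fstar} ≤ ENNReal.ofReal
      ((1 - δ + δ * Real.exp (-s)) ^ k * (f x₀ - fstar) ^ θ / B) := by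
    rw [ENNReal.ofReal_div_of_pos hB0]
    exact hmarkov.trans (ENNReal.div_le_div_right hE' _)
  have hreal := ENNReal.toReal_mono ENNReal.ofReal_ne_top hbound
  rw [ENNReal.toReal_ofReal (by positivity)] at hreal
  refine hreal.trans (le_trans (le_of_eq ?_)
    (SubspaceDescent.chernoff_bernoulli_le (t := t) hδ_pos hδ_lt k hs))
  rw [hBeq, Real.exp_neg (s * (δ - t) * k)]
  have := Real.exp_pos (s * (δ - t) * k)
  field_simp
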